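/- Let $\mathbb D=\{z\in\mathbb C:|z|<1\}$, $dA=\frac{dx\,dy}{\pi}$, and let $\mathcal H(\mathbb D)$ be the space of analytic functions in $\mathbb D$. Let $\omega$ be a radial weight, that is, a nonnegative function $\omega\in L^1([0,1))$, extended to $\mathbb D$ by $\omega(z)=\omega(|z|)$, such that $\int_r^1\omega(s)\,ds>0$ for all $0\le r<1$. For $p\in\{1,2\}$ let $A^p_\omega$ be the space of $f\in\mathcal H(\mathbb D)$ with $\|f\|_{A^p_\omega}^p=\int_{\mathbb D}|f|^p\omega\,dA<\infty$, let $B^\omega_z$ be the reproducing kernels of $A^2_\omega$, and let $$P_\omega(g)(z)=\int_{\mathbb D}g(\zeta)\overline{B^\omega_z(\zeta)}\,\omega(\zeta)\,dA(\zeta),\qquad z\in\mathbb D,$$ be the associated Bergman projection. The Bloch space $\mathcal B$ consists of $f\in\mathcal H(\mathbb D)$ with $\|f\|_{\mathcal B}=\sup_{z\in\mathbb D}|f'(z)|(1-|z|^2)+|f(0)|<\infty$, and the little Bloch space $\mathcal B_0$ of $f\in\mathcal H(\mathbb D)$ with $f'(z)(1-|z|^2)\to0$ as $|z|\to1^-$.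 The $A^2_\omega$-pairing is $$\langle f,g\rangle_{A^2_\omega}=\lim_{r\to1^-}\int_{\mathbb D}f(rz)\overline{g(z)}\,\omega(z)\,dA(z).$$ For $x\ge0$ and $\beta>0$ write $\omega_x=\int_0^1r^x\omega(r)\,dr$ and $(\omega_{[\beta]})_x=\int_0^1r^x(1-r)^\beta\omega(r)\,dr$. Then the following statements are equivalent: (i) There exists $C=C(\omega)>0$ such that for each $f\in\mathcal B$ there is $g\in L^\infty(\mathbb D)$ with $P_\omega(g)=f$ and $\|g\|_{L^\infty}\le C\|f\|_{\mathcal B}$. (ii) There exists $C=C(\omega)>0$ such that for all $f\in A^1_\omega$ and $g\in\mathcal B$ the pairing $\langle f,g\rangle_{A^2_\omega}$ exists (the integrals converge absolutely for $0<r<1$ and the limit exists) and $|\langle f,g\rangle_{A^2_\omega}|\le C\|g\|_{\mathcal B}\|f\|_{A^1_\omega}$. (iii) There exists $C=C(\omega)>0$ such that for all $f\in A^1_\omega$ and $g\in\mathcal B_0$ the pairing $\langle g,f\rangle_{A^2_\omega}$ exists (in the same sense) and $|\langle g,f\rangle_{A^2_\omega}|\le C\|g\|_{\mathcal B}\|f\|_{A^1_\omega}$.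 (iv) $\omega\in\mathcal M$, that is, there exist constants $C=C(\omega)>1$ and $K=K(\omega)>1$ such that $\omega_x\ge C\,\omega_{Kx}$ for all $x\ge1$. (v) For some $\beta>0$ there exists $C=C(\omega,\beta)>0$ such that $\omega_x\le C x^\beta(\omega_{[\beta]})_x$ for all $1\le x<\infty$. (vi) For each $\beta>0$ there exists $C=C(\omega,\beta)>0$ such that $\omega_x\le C x^\beta(\omega_{[\beta]})_x$ for all $1\le x<\infty$. -/

import Mathlib

open MeasureTheory Set Filter Topology
open scoped ENNReal ComplexConjugate

noncomputable section

namespace RadialBergman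

/-- The open unit disc. -/
def unitDisc : Set ℂ := Metric.ball 0 1

/-- The normalized area measure `dA = dx dy / π` on the unit disc. -/
def areaMeasure : Measure ℂ := ENNReal.ofReal Real.pi⁻¹ • volume.restrict unitDisc

/-- `ω` represents a radial weight: it is nonnegative and integrable on `[0,1)`, and its tail
integrals `∫_r^1 ω(s) ds`, `0 ≤ r < 1`, are all strictly positive. The induced weight on the disc
is `z ↦ ω ‖z‖`; values of `ω` outside `[0,1)` are never used. -/
structure IsRadialWeight (ω : ℝ → ℝ) : Prop where
  nonneg : ∀ r ∈ Ico (0 : ℝ) 1, 0 ≤ ω r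
  integrableOn : IntegrableOn ω (Ico 0 1) volume
  tail_pos : ∀ r ∈ Ico (0 : ℝ) 1, 0 < ∫ s in r..1, ω s

/-- The measure `ω(z) dA(z)` on the unit disc. -/
def weightedMeasure (ω : ℝ → ℝ) : Measure ℂ :=
  areaMeasure.withDensity fun z => ENNReal.ofReal (ω ‖z‖)

/-- `f` is analytic in the unit disc. -/
def IsAnalyticInDisc (f : ℂ → ℂ) : Prop := DifferentiableOn ℂ f unitDisc

/-- Membership in the weighted Bergman space `A^p_ω = L^p_ω ∩ H(𝔻)`. -/
def MemBergman (p : ℝ≥0∞) (ω : ℝ → ℝ) (f : ℂ → ℂ) : Prop :=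
  IsAnalyticInDisc f ∧ MemLp f p (weightedMeasure ω)

/-- The norm of `A^p_ω`. -/
def bergmanNorm (p : ℝ≥0∞) (ω : ℝ → ℝ) (f : ℂ → ℂ) : ℝ :=
  (eLpNorm f p (weightedMeasure ω)).toReal

/-- `k` is the reproducing kernel of `A^2_ω` at the point `z`. -/
def IsReproducingKernelAt (ω : ℝ → ℝ) (z : ℂ) (k : ℂ → ℂ) : Prop :=
  MemBergman 2 ω k ∧
    ∀ f : ℂ → ℂ, MemBergman 2 ω f → f z = ∫ ζ, f ζ * conj (k ζ) ∂(weightedMeasure ω)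

/-- The reproducing kernel `B^ω_z` of `A^2_ω`. Its values on the disc are uniquely determined by
the reproducing property; values off the disc are irrelevant. -/
def bergmanKernel (ω : ℝ → ℝ) (z : ℂ) : ℂ → ℂ :=
  Classical.epsilon (IsReproducingKernelAt ω z)

/-- The Bergman projection `P_ω(f)(z) = ∫_𝔻 f(ζ) conj(B^ω_z(ζ)) ω(ζ) dA(ζ)`. -/
def bergmanProjection (ω : ℝ → ℝ) (f : ℂ → ℂ) (z : ℂ) : ℂ :=
  ∫ ζ, f ζ * conj (bergmanKernel ω z ζ) ∂(weightedMeasure ω)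

/-- Membership in `L^∞` of the unit disc (with respect to area measure). -/
def MemLinfty (g : ℂ → ℂ) : Prop := MemLp g ∞ areaMeasure

/-- The `L^∞` norm on the unit disc. -/
def linftyNorm (g : ℂ → ℂ) : ℝ := (eLpNorm g ∞ areaMeasure).toReal

/-- The function `z ↦ |f'(z)| (1 - |z|²)`. -/
def blochDensity (f : ℂ → ℂ) (z : ℂ) : ℝ := ‖deriv f z‖ * (1 - ‖z‖ ^ 2)

/-- Membership in the Bloch space `𝓑`. -/
def MemBloch (f : ℂ → ℂ) : Prop :=
  IsAnalyticInDisc f ∧ BddAbove (blochDensity f '' unitDisc)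

/-- The Bloch norm `sup_{z ∈ 𝔻} |f'(z)| (1 - |z|²) + |f(0)|`. -/
def blochNorm (f : ℂ → ℂ) : ℝ := sSup (blochDensity f '' unitDisc) + ‖f 0‖

/-- Membership in the little Bloch space `𝓑₀`: `|f'(z)| (1 - |z|²) → 0` as `|z| → 1⁻`. -/
def MemLittleBloch (f : ℂ → ℂ) : Prop :=
  IsAnalyticInDisc f ∧ Tendsto (blochDensity f) (comap (fun z : ℂ => ‖z‖) (𝓝[<] 1)) (𝓝 0)

/-- The `A^2_ω`-pairing `⟨f, g⟩ = lim_{r → 1⁻} ∫_𝔻 f(rz) conj(g(z)) ω(z) dA(z)` exists and has the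
value `L`: all the integrals converge absolutely and they tend to `L`. -/
def HasPairing (ω : ℝ → ℝ) (f g : ℂ → ℂ) (L : ℂ) : Prop :=
  (∀ r ∈ Ioo (0 : ℝ) 1,
    Integrable (fun z : ℂ => f (r * z) * conj (g z)) (weightedMeasure ω)) ∧
  Tendsto (fun r : ℝ => ∫ z, f (r * z) * conj (g z) ∂(weightedMeasure ω)) (𝓝[<] 1) (𝓝 L)

/-- The moments `ω_x = ∫_0^1 r^x ω(r) dr`, `x ≥ 0`. -/
def moment (ω : ℝ → ℝ) (x : ℝ) : ℝ := ∫ r in (0 : ℝ)..1, r ^ x * ω r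

/-- The class `𝓜`: there are `C, K > 1` with `ω_x ≥ C ω_{Kx}` for all `x ≥ 1`. -/
def ClassM (ω : ℝ → ℝ) : Prop :=
  ∃ C K : ℝ, 1 < C ∧ 1 < K ∧ ∀ x : ℝ, 1 ≤ x → C * moment ω (K * x) ≤ moment ω x

/-- The weight `ω_{[β]}(r) = ω(r) (1 - r)^β`. -/
def powerWeight (ω : ℝ → ℝ) (β : ℝ) (r : ℝ) : ℝ := ω r * (1 - r) ^ β

end RadialBergman

end

/-! ### The measure ω dA: finiteness, rotation invariance, moments -/

namespace RadialBergman

variable {ω : ℝ → ℝ}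

/-! Monomials are orthogonal for the measure ω dA, so everything is governed by the moments m_n = ∫
|z|^(2n) ω dA = 2 ω_{2n+1}: the kernel is Σ (conj z · w)^n / m_n, and P_ω(h) has Taylor coefficients
m_n⁻¹ ∫ h conj(ζ)^n ω dA. The implications form the cycle (i) → (ii) → (iii) → (iv) → (i), with the
loop (iv) → (vi) → (v) → (iv) attached.

(i) → (ii) is duality: if g = P_ω(h) with h bounded, then ⟨f, g⟩ = ∫ f conj(h) ω dA. The passage to
the limit needs f(r·) → f in A^1_ω (`tendsto_integral_norm_dilation_sub`). (ii) → (iii) holds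
because the coefficient series of the pairing is symmetric up to conjugation.

(iii) → (iv) tests the pairing on f = g, a sum of s² lacunary monomials z^(2^(j+1) t). Its Bloch
norm is at most 4 for every s (`blochNorm_lacunary_le`), its A^1_ω norm is at most s m_t
(`integral_norm_lacunary_le`), yet the pairing is a sum of s² moments. Once s exceeds a multiple of
the constant in (iii), the moments must halve along a bounded ratio of exponents.

(iv) → (i) constructs a bounded preimage. De la Vallée Poussin multipliers cut the Taylor series of
a Bloch function into blocks with frequencies in [a, b], 2b ≤ 3a, each of size O(‖f‖_𝓑) on the unit
circle (`MemBloch.norm_block_le`). The function z^n (r^(2a) - r^(2Ka)) / r^(2n), r = |z|, has the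
single nonzero moment m_a - m_{Ka}, whatever n is. So each block is P_ω of an explicit symbol, and
(iv) says exactly that dividing by m_a - m_{Ka} is no worse than dividing by m_a. The symbol is O(a
(1-√r) √r^a) (`norm_blockSymbol_le`), and these bounds have a bounded sum over the exponentially
growing a (`sum_blockLow_mul_pow_le`).

The moment inequalities are pointwise comparisons of r^x, r^(Kx) and (x(1-r))^β r^x, split according
to whether x(1-r) is small. -/

lemma measurableSet_unitDisc : MeasurableSet unitDisc := Metric.isOpen_ball.measurableSet

lemma isOpen_unitDisc : IsOpen unitDisc := Metric.isOpen_ball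

lemma mem_unitDisc {z : ℂ} : z ∈ unitDisc ↔ ‖z‖ < 1 := by simp [unitDisc]

lemma ae_areaMeasure_mem_unitDisc : ∀ᵐ z ∂areaMeasure, z ∈ unitDisc :=
  Measure.ae_smul_measure (ae_restrict_mem measurableSet_unitDisc) _

lemma weightedMeasure_absolutelyContinuous : weightedMeasure ω ≪ areaMeasure :=
  withDensity_absolutelyContinuous _ _

lemma ae_mem_unitDisc : ∀ᵐ z ∂weightedMeasure ω, z ∈ unitDisc :=
  weightedMeasure_absolutelyContinuous.ae_le ae_areaMeasure_mem_unitDisc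

lemma ae_norm_lt_one : ∀ᵐ z ∂weightedMeasure ω, ‖z‖ < 1 :=
  ae_mem_unitDisc.mono fun _ h => mem_unitDisc.1 h

namespace IsRadialWeight

lemma integrableOn_pow_mul (hω : IsRadialWeight ω) (n : ℕ) :
    IntegrableOn (fun r : ℝ => r ^ n * ω r) (Ioo 0 1) := by
  have h : IntegrableOn ω (Ioo 0 1) := hω.integrableOn.mono_set Ioo_subset_Ico_self
  refine Integrable.mono h ?_ ?_
  · exact (Measurable.aestronglyMeasurable (by fun_prop)).mul h.aestronglyMeasurable
  · filter_upwards [ae_restrict_mem measurableSet_Ioo] with r hr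
    rw [norm_mul]
    refine mul_le_of_le_one_left (norm_nonneg _) ?_
    rw [norm_pow, Real.norm_of_nonneg hr.1.le]
    exact pow_le_one₀ hr.1.le hr.2.le

lemma integrable_weight (hω : IsRadialWeight ω) :
    Integrable (fun z : ℂ => ω ‖z‖) areaMeasure := by
  refine Integrable.smul_measure ?_ ENNReal.ofReal_ne_top
  change IntegrableOn _ (Metric.ball 0 1) _
  rw [integrableOn_fun_norm_addHaar]
  simpa using hω.integrableOn_pow_mul 1

lemma aemeasurable_weight (hω : IsRadialWeight ω) :
    AEMeasurable (fun z : ℂ => ENNReal.ofReal (ω ‖z‖)) areaMeasure :=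
  hω.integrable_weight.aemeasurable.ennreal_ofReal

lemma ae_nonneg_weight (hω : IsRadialWeight ω) : ∀ᵐ z ∂areaMeasure, 0 ≤ ω ‖z‖ := by
  filter_upwards [ae_areaMeasure_mem_unitDisc] with z hz
  exact hω.nonneg _ ⟨norm_nonneg _, mem_unitDisc.1 hz⟩

lemma isFiniteMeasure (hω : IsRadialWeight ω) : IsFiniteMeasure (weightedMeasure ω) :=
  isFiniteMeasure_withDensity_ofReal hω.integrable_weight.2

lemma integral_eq {E : Type*} [NormedAddCommGroup E] [NormedSpace ℝ E] (hω : IsRadialWeight ω)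
    (F : ℂ → E) :
    ∫ z, F z ∂weightedMeasure ω = ∫ z, ω ‖z‖ • F z ∂areaMeasure := by
  rw [weightedMeasure, integral_withDensity_eq_integral_toReal_smul₀ hω.aemeasurable_weight
    (by simp)]
  refine integral_congr_ae ?_
  filter_upwards [hω.ae_nonneg_weight] with z hz
  rw [ENNReal.toReal_ofReal hz]

end IsRadialWeight

/-- The moment `∫ |z|^n ω(z) dA(z)` of the weighted area measure. -/
noncomputable def normMoment (ω : ℝ → ℝ) (n : ℕ) : ℝ := ∫ z, ‖z‖ ^ n ∂weightedMeasure ω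

lemma moment_eq_setIntegral (x : ℝ) :
    moment ω x = ∫ r in Ioo (0 : ℝ) 1, r ^ x * ω r := by
  rw [moment, intervalIntegral.integral_of_le zero_le_one, integral_Ioc_eq_integral_Ioo]

lemma measurePreserving_rotation {u : ℂ} (hu : ‖u‖ = 1) :
    MeasurePreserving (fun z : ℂ => u * z) (weightedMeasure ω) (weightedMeasure ω) := by
  have hu0 : u ≠ 0 := by rintro rfl; simp at hu
  have hemb : MeasurableEmbedding (fun z : ℂ => u * z) :=
    (Homeomorph.mulLeft₀ u hu0).measurableEmbedding
  have h1 : MeasurePreserving (fun z : ℂ => u * z) volume volume := by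
    have := (rotation ⟨u, by simp [Submonoid.unitSphere, hu]⟩).measurePreserving
    exact this
  have hpre : (fun z : ℂ => u * z) ⁻¹' unitDisc = unitDisc := by
    ext z; simp [mem_unitDisc, hu]
  have h2 : MeasurePreserving (fun z : ℂ => u * z) areaMeasure areaMeasure := by
    have := h1.restrict_preimage_emb hemb unitDisc
    rw [hpre] at this
    exact this.smul_measure _
  refine ⟨hemb.measurable, Measure.ext fun s hs => ?_⟩
  rw [Measure.map_apply hemb.measurable hs, weightedMeasure,
    withDensity_apply _ (hemb.measurable hs), withDensity_apply _ hs,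
    ← h2.setLIntegral_comp_preimage_emb hemb (fun z => ENNReal.ofReal (ω ‖z‖)) s]
  simp [hu]

lemma measurableEmbedding_rotation {u : ℂ} (hu : ‖u‖ = 1) :
    MeasurableEmbedding (fun z : ℂ => u * z) :=
  (Homeomorph.mulLeft₀ u (by rintro rfl; simp at hu)).measurableEmbedding

lemma integral_rotation {E : Type*} [NormedAddCommGroup E] [NormedSpace ℝ E] {u : ℂ}
    (hu : ‖u‖ = 1) (F : ℂ → E) :
    ∫ z, F (u * z) ∂weightedMeasure ω = ∫ z, F z ∂weightedMeasure ω :=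
  (measurePreserving_rotation hu).integral_comp (measurableEmbedding_rotation hu) F

namespace IsRadialWeight

lemma integrableOn_rpow_mul (hω : IsRadialWeight ω) {x : ℝ} (hx : 0 ≤ x) :
    IntegrableOn (fun r : ℝ => r ^ x * ω r) (Ioo 0 1) := by
  have h : IntegrableOn ω (Ioo 0 1) := hω.integrableOn.mono_set Ioo_subset_Ico_self
  refine Integrable.mono h ?_ ?_
  · exact (Measurable.aestronglyMeasurable (by fun_prop)).mul h.aestronglyMeasurable
  · filter_upwards [ae_restrict_mem measurableSet_Ioo] with r hr
    rw [norm_mul]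
    refine mul_le_of_le_one_left (norm_nonneg _) ?_
    rw [Real.norm_of_nonneg (Real.rpow_nonneg hr.1.le _)]
    exact Real.rpow_le_one hr.1.le hr.2.le hx

lemma moment_mono (hω : IsRadialWeight ω) {φ ψ : ℝ → ℝ}
    (hφ : IntegrableOn (fun r => φ r * ω r) (Ioo 0 1))
    (hψ : IntegrableOn (fun r => ψ r * ω r) (Ioo 0 1))
    (h : ∀ r ∈ Ioo (0 : ℝ) 1, φ r ≤ ψ r) :
    ∫ r in Ioo (0 : ℝ) 1, φ r * ω r ≤ ∫ r in Ioo (0 : ℝ) 1, ψ r * ω r :=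
  setIntegral_mono_on hφ hψ measurableSet_Ioo fun r hr =>
    mul_le_mul_of_nonneg_right (h r hr) (hω.nonneg r ⟨hr.1.le, hr.2⟩)

lemma moment_antitone (hω : IsRadialWeight ω) {x y : ℝ} (hx : 0 ≤ x) (hxy : x ≤ y) :
    moment ω y ≤ moment ω x := by
  rw [moment_eq_setIntegral, moment_eq_setIntegral]
  exact hω.moment_mono (hω.integrableOn_rpow_mul (hx.trans hxy)) (hω.integrableOn_rpow_mul hx)
    fun r hr => Real.rpow_le_rpow_of_exponent_ge hr.1 hr.2.le hxy

lemma rpow_mul_tail_le_moment (hω : IsRadialWeight ω) {x ρ : ℝ} (hx : 0 ≤ x)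
    (hρ : ρ ∈ Ioo (0 : ℝ) 1) : ρ ^ x * ∫ s in ρ..1, ω s ≤ moment ω x := by
  have h : IntegrableOn ω (Ioo 0 1) := hω.integrableOn.mono_set Ioo_subset_Ico_self
  have hsub : Ioo ρ 1 ⊆ Ioo 0 1 := Ioo_subset_Ioo_left hρ.1.le
  rw [moment_eq_setIntegral, intervalIntegral.integral_of_le hρ.2.le,
    integral_Ioc_eq_integral_Ioo, ← integral_const_mul]
  calc ∫ r in Ioo ρ 1, ρ ^ x * ω r ≤ ∫ r in Ioo ρ 1, r ^ x * ω r := by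
        refine setIntegral_mono_on ((h.mono_set hsub).const_mul _)
          ((hω.integrableOn_rpow_mul hx).mono_set hsub) measurableSet_Ioo fun r hr => ?_
        exact mul_le_mul_of_nonneg_right (Real.rpow_le_rpow hρ.1.le hr.1.le hx)
          (hω.nonneg r ⟨(hsub hr).1.le, hr.2⟩)
    _ ≤ _ := by
        refine setIntegral_mono_set (hω.integrableOn_rpow_mul hx) ?_ hsub.eventuallyLE
        filter_upwards [ae_restrict_mem measurableSet_Ioo] with r hr
        exact mul_nonneg (Real.rpow_nonneg hr.1.le _) (hω.nonneg r ⟨hr.1.le, hr.2⟩)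

lemma moment_pos (hω : IsRadialWeight ω) {x : ℝ} (hx : 0 ≤ x) : 0 < moment ω x := by
  have hρ : (1 / 2 : ℝ) ∈ Ioo (0 : ℝ) 1 := by norm_num
  refine lt_of_lt_of_le ?_ (hω.rpow_mul_tail_le_moment hx hρ)
  exact mul_pos (Real.rpow_pos_of_pos hρ.1 _) (hω.tail_pos _ ⟨hρ.1.le, hρ.2⟩)

/-- Polar coordinates: the Jacobian r shifts the exponent by one, and the factor 2 is 2π divided by
the normalization π. -/
lemma normMoment_eq (hω : IsRadialWeight ω) (n : ℕ) :
    normMoment ω n = 2 * moment ω (n + 1) := by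
  have key := integral_fun_norm_addHaar (volume : Measure ℂ)
    (fun r : ℝ => (Iio (1 : ℝ)).indicator (fun r => ω r * r ^ n) r)
  have e1 : ∀ z : ℂ, (Iio (1 : ℝ)).indicator (fun r => ω r * r ^ n) ‖z‖
      = unitDisc.indicator (fun z : ℂ => ω ‖z‖ * ‖z‖ ^ n) z := by
    intro z
    by_cases h : ‖z‖ < 1 <;> simp [indicator, h, mem_unitDisc]
  simp only [e1] at key
  rw [integral_indicator measurableSet_unitDisc] at key
  have e2 : (volume : Measure ℂ).real (Metric.ball 0 1) = Real.pi := by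
    simp [Measure.real, Complex.volume_ball]
  have e3 : ∫ y in Ioi (0 : ℝ), y ^ (Module.finrank ℝ ℂ - 1) •
      (Iio (1 : ℝ)).indicator (fun r => ω r * r ^ n) y = moment ω (n + 1) := by
    have : ∀ y : ℝ, y ^ (Module.finrank ℝ ℂ - 1) •
      (Iio (1 : ℝ)).indicator (fun r => ω r * r ^ n) y =
        (Iio (1 : ℝ)).indicator (fun r => r ^ ((n : ℝ) + 1) * ω r) y := by
      intro y
      by_cases h : y < 1
      · have : y ^ ((n : ℝ) + 1) = y ^ (n + 1) := by exact_mod_cast Real.rpow_natCast y (n + 1)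
        simp [indicator, h, this, pow_succ]
        ring
      · simp [indicator, h]
    simp only [this]
    rw [setIntegral_indicator measurableSet_Iio, Ioi_inter_Iio, moment_eq_setIntegral]
  rw [e2, e3] at key
  rw [normMoment, hω.integral_eq, areaMeasure, integral_smul_measure]
  simp only [smul_eq_mul]
  rw [key, ENNReal.toReal_ofReal (by positivity)]
  simp
  field_simp

lemma normMoment_pos (hω : IsRadialWeight ω) (n : ℕ) : 0 < normMoment ω n := by
  rw [hω.normMoment_eq]
  exact mul_pos two_pos (hω.moment_pos (by positivity))

lemma normMoment_antitone (hω : IsRadialWeight ω) {m n : ℕ} (h : m ≤ n) :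
    normMoment ω n ≤ normMoment ω m := by
  rw [hω.normMoment_eq, hω.normMoment_eq]
  have : (m : ℝ) ≤ n := by exact_mod_cast h
  gcongr
  exact hω.moment_antitone (by positivity) (by linarith)

/-- The weight has mass beyond every ρ < 1, so moments decay slower than any geometric sequence.
This is what makes the kernel series converge. -/
lemma exists_le_normMoment (hω : IsRadialWeight ω) {ρ : ℝ} (hρ : ρ ∈ Ioo (0 : ℝ) 1) :
    ∃ κ : ℝ, 0 < κ ∧ ∀ n : ℕ, κ * ρ ^ n ≤ normMoment ω n := by
  refine ⟨2 * ρ * ∫ s in ρ..1, ω s, ?_, fun n => ?_⟩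
  · have := hω.tail_pos ρ ⟨hρ.1.le, hρ.2⟩
    have := hρ.1
    positivity
  · rw [hω.normMoment_eq]
    have := hω.rpow_mul_tail_le_moment (x := n + 1) (by positivity) hρ
    have e : ρ ^ ((n : ℝ) + 1) = ρ ^ (n + 1) := by exact_mod_cast Real.rpow_natCast ρ (n + 1)
    rw [e, pow_succ] at this
    linarith

end IsRadialWeight

end RadialBergman

/-! ### The class 𝓜 and the moment inequalities -/

namespace RadialBergman

variable {ω : ℝ → ℝ}

lemma moment_powerWeight (β x : ℝ) :
    moment (powerWeight ω β) x = ∫ r in Ioo (0 : ℝ) 1, (r ^ x * (1 - r) ^ β) * ω r := by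
  rw [moment_eq_setIntegral]
  congr 1
  ext r
  rw [powerWeight]; ring

lemma IsRadialWeight.integrableOn_rpow_mul_powerWeight (hω : IsRadialWeight ω) {x β : ℝ}
    (hx : 0 ≤ x) (hβ : 0 ≤ β) :
    IntegrableOn (fun r : ℝ => (r ^ x * (1 - r) ^ β) * ω r) (Ioo 0 1) := by
  have h : IntegrableOn ω (Ioo 0 1) := hω.integrableOn.mono_set Ioo_subset_Ico_self
  refine Integrable.mono (hω.integrableOn_rpow_mul hx) ?_ ?_
  · exact (Measurable.aestronglyMeasurable (by fun_prop)).mul h.aestronglyMeasurable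
  · filter_upwards [ae_restrict_mem measurableSet_Ioo] with r hr
    rw [norm_mul, norm_mul, norm_mul]
    gcongr
    refine mul_le_of_le_one_right (norm_nonneg _) ?_
    rw [Real.norm_of_nonneg (Real.rpow_nonneg (by linarith [hr.2]) _)]
    exact Real.rpow_le_one (by linarith [hr.2]) (by linarith [hr.1]) hβ

/-- Where x(1-r) is small, r^x and r^(Kx) are comparable with a constant below C; elsewhere
(x(1-r))^β is bounded below. After integration the ω_{Kx} term is absorbed by the class 𝓜
inequality. -/
lemma ClassM.moment_le_powerWeight (hω : IsRadialWeight ω) (hM : ClassM ω) {β : ℝ} (hβ : 0 < β) :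
    ∃ C : ℝ, 0 < C ∧ ∀ x : ℝ, 1 ≤ x →
      moment ω x ≤ C * x ^ β * moment (powerWeight ω β) x := by
  obtain ⟨C, K, hC, hK, h⟩ := hM
  -- Any q in (1, C) works: q > 1 leaves room for δ > 0, and q < C allows the absorption.
  set q := (1 + C) / 2 with hq
  have hq1 : 1 < q := by rw [hq]; linarith
  have hqC : q < C := by rw [hq]; linarith
  -- Solves (1 - δ)^(K-1) = 1/q; Bernoulli then gives r^x ≥ 1 - δ, hence r^x ≤ q r^(Kx), when x(1-r)
  -- ≤ δ.
  set δ := 1 - q⁻¹ ^ (1 / (K - 1)) with hδ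
  have hK1 : 0 < K - 1 := by linarith
  have hqi : q⁻¹ < 1 := inv_lt_one_of_one_lt₀ hq1
  have hqi0 : 0 < q⁻¹ := by positivity
  have hδ0 : 0 < δ := by
    rw [hδ]
    have := Real.rpow_lt_one hqi0.le hqi (z := 1 / (K - 1)) (by positivity)
    linarith
  have hδ1 : δ < 1 := by
    rw [hδ]
    have := Real.rpow_pos_of_pos hqi0 (1 / (K - 1))
    linarith
  have hδK : (1 - δ) ^ (K - 1) = q⁻¹ := by
    rw [hδ, sub_sub_cancel, ← Real.rpow_mul hqi0.le]
    rw [one_div_mul_cancel hK1.ne', Real.rpow_one]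
  have pointwise : ∀ x : ℝ, 1 ≤ x → ∀ r ∈ Ioo (0 : ℝ) 1,
      r ^ x ≤ q * r ^ (K * x) + δ⁻¹ ^ β * x ^ β * (r ^ x * (1 - r) ^ β) := by
    intro x hx r hr
    have hr1 : 0 < 1 - r := by linarith [hr.2]
    have hrx : 0 < r ^ x := Real.rpow_pos_of_pos hr.1 _
    have hrK : 0 < r ^ (K * x) := Real.rpow_pos_of_pos hr.1 _
    by_cases hc : x * (1 - r) ≤ δ
    · have hb : 1 - δ ≤ r ^ x := by
        have := one_add_mul_self_le_rpow_one_add (s := r - 1) (by linarith [hr.1]) hx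
        rw [add_sub_cancel] at this
        linarith
      have h3 : q⁻¹ ≤ r ^ (x * (K - 1)) := by
        rw [Real.rpow_mul hr.1.le, ← hδK]
        exact Real.rpow_le_rpow (by linarith) hb hK1.le
      have h4 : r ^ (K * x) = r ^ x * r ^ (x * (K - 1)) := by
        rw [← Real.rpow_add hr.1]; ring_nf
      have h5 : 0 ≤ δ⁻¹ ^ β * x ^ β * (r ^ x * (1 - r) ^ β) := by positivity
      have h6 : 1 ≤ q * r ^ (x * (K - 1)) := by
        calc 1 = q * q⁻¹ := by field_simp
          _ ≤ _ := by gcongr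
      rw [h4]
      nlinarith
    · push Not at hc
      have h1 : 1 ≤ δ⁻¹ ^ β * x ^ β * (1 - r) ^ β := by
        rw [← Real.mul_rpow (by positivity) (by positivity),
          ← Real.mul_rpow (by positivity) hr1.le]
        refine Real.one_le_rpow ?_ hβ.le
        rw [mul_assoc, inv_mul_eq_div, one_le_div hδ0]
        exact hc.le
      have h2 : 0 ≤ q * r ^ (K * x) := by positivity
      nlinarith
  have hqC' : 0 < 1 - q / C := by
    rw [sub_pos, div_lt_one (by linarith)]; exact hqC
  refine ⟨(1 - q / C)⁻¹ * δ⁻¹ ^ β, by positivity, fun x hx => ?_⟩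
  have hx0 : 0 ≤ x := by linarith
  have hKx : 0 ≤ K * x := by positivity
  have i1 := hω.integrableOn_rpow_mul hx0
  have i2 := hω.integrableOn_rpow_mul hKx
  have i3 := hω.integrableOn_rpow_mul_powerWeight hx0 hβ.le
  have main : moment ω x ≤ q * moment ω (K * x)
      + δ⁻¹ ^ β * x ^ β * moment (powerWeight ω β) x := by
    rw [moment_powerWeight, moment_eq_setIntegral, moment_eq_setIntegral, ← integral_const_mul,
      ← integral_const_mul, ← integral_add (i2.const_mul _) (i3.const_mul _)]
    refine setIntegral_mono_on (f := fun r => r ^ x * ω r)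
      (g := fun r => q * (r ^ (K * x) * ω r) + δ⁻¹ ^ β * x ^ β * (r ^ x * (1 - r) ^ β * ω r))
      i1 ((i2.const_mul _).add (i3.const_mul _)) measurableSet_Ioo ?_
    intro r hr
    have := mul_le_mul_of_nonneg_right (pointwise x hx r hr) (hω.nonneg r ⟨hr.1.le, hr.2⟩)
    linarith
  have hCK := h x hx
  have h7 : moment ω (K * x) ≤ moment ω x / C := by
    rw [le_div_iff₀ (by linarith)]; linarith
  have h8 : (1 - q / C) * moment ω x ≤ δ⁻¹ ^ β * x ^ β * moment (powerWeight ω β) x := by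
    have : q * moment ω (K * x) ≤ q * (moment ω x / C) := by gcongr
    have e : (1 - q / C) * moment ω x = moment ω x - q * (moment ω x / C) := by ring
    linarith
  rw [mul_assoc, mul_assoc, ← div_eq_inv_mul, le_div_iff₀ hqC']
  linarith

lemma rpow_mul_exp_neg_half_le {β t : ℝ} (hβ : 0 < β) (ht : 0 ≤ t) :
    t ^ β * Real.exp (-t / 2) ≤ (2 * β) ^ β := by
  have h1 : t / (2 * β) ≤ Real.exp (t / (2 * β)) := by
    linarith [Real.add_one_le_exp (t / (2 * β))]
  have h2 : t ^ β ≤ (2 * β) ^ β * Real.exp (t / 2) := by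
    calc t ^ β = (2 * β * (t / (2 * β))) ^ β := by congr 1; field_simp
      _ ≤ (2 * β * Real.exp (t / (2 * β))) ^ β := by gcongr
      _ = (2 * β) ^ β * Real.exp (t / 2) := by
        rw [Real.mul_rpow (by positivity) (by positivity), ← Real.exp_mul]
        congr 2
        field_simp
  calc t ^ β * Real.exp (-t / 2) ≤ (2 * β) ^ β * Real.exp (t / 2) * Real.exp (-t / 2) := by gcongr
    _ = (2 * β) ^ β := by rw [mul_assoc, ← Real.exp_add]; ring_nf; simp

/-- The hypothesis is used at 2x, so that r^(2x) = r^x · r^x has one factor to absorb (2x(1-r))^β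
and one to compare with r^x - r^(2x). This yields ω_{2x} ≤ ω_{2x}/2 + CA(ω_x - ω_{2x}). -/
lemma classM_of_moment_le_powerWeight (hω : IsRadialWeight ω) {β C : ℝ} (hβ : 0 < β) (hC : 0 < C)
    (h : ∀ x : ℝ, 1 ≤ x → moment ω x ≤ C * x ^ β * moment (powerWeight ω β) x) : ClassM ω := by
  -- For 2x(1-r) ≤ δ the power is at most 1/(2C), which produces the half that is absorbed; for
  -- larger values 1 - r^x ≥ 1 - exp(-δ/2).
  set δ := (2 * C)⁻¹ ^ (1 / β) with hδ
  have hδ0 : 0 < δ := by positivity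
  have hδβ : δ ^ β = (2 * C)⁻¹ := by
    rw [hδ, ← Real.rpow_mul (by positivity), one_div_mul_cancel hβ.ne', Real.rpow_one]
  have he : 0 < 1 - Real.exp (-δ / 2) := by
    rw [sub_pos, Real.exp_lt_one_iff]; linarith
  set A := (2 * β) ^ β / (1 - Real.exp (-δ / 2)) with hA
  have hA0 : 0 < A := by positivity
  have pointwise : ∀ x : ℝ, 1 ≤ x → ∀ r ∈ Ioo (0 : ℝ) 1,
      (2 * x) ^ β * (r ^ (2 * x) * (1 - r) ^ β)
        ≤ (2 * C)⁻¹ * r ^ (2 * x) + A * (r ^ x - r ^ (2 * x)) := by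
    intro x hx r hr
    have hr1 : 0 < 1 - r := by linarith [hr.2]
    have hrx : 0 < r ^ x := Real.rpow_pos_of_pos hr.1 _
    have hr2 : r ^ (2 * x) = r ^ x * r ^ x := by rw [two_mul, Real.rpow_add hr.1]
    have hle : r ^ x ≤ 1 := Real.rpow_le_one hr.1.le hr.2.le (by linarith)
    have hexp : r ^ x ≤ Real.exp (-(2 * x * (1 - r)) / 2) := by
      have : r ≤ Real.exp (-(1 - r)) := by linarith [Real.add_one_le_exp (-(1 - r))]
      calc r ^ x ≤ Real.exp (-(1 - r)) ^ x := Real.rpow_le_rpow hr.1.le this (by linarith)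
        _ = _ := by rw [← Real.exp_mul]; congr 1; ring
    have e : (2 * x) ^ β * (r ^ (2 * x) * (1 - r) ^ β)
        = (2 * x * (1 - r)) ^ β * r ^ (2 * x) := by
      rw [Real.mul_rpow (x := 2 * x) (by linarith) hr1.le]; ring
    rw [e]
    by_cases hc : 2 * x * (1 - r) ≤ δ
    · have h1 : (2 * x * (1 - r)) ^ β ≤ (2 * C)⁻¹ := by
        rw [← hδβ]; exact Real.rpow_le_rpow (by positivity) hc hβ.le
      have h2 : 0 ≤ A * (r ^ x - r ^ (2 * x)) := by
        refine mul_nonneg hA0.le ?_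
        rw [hr2]; nlinarith
      have h3 : 0 < r ^ (2 * x) := Real.rpow_pos_of_pos hr.1 _
      nlinarith
    · push Not at hc
      have h1 : (2 * x * (1 - r)) ^ β * r ^ x ≤ (2 * β) ^ β := by
        refine le_trans ?_ (rpow_mul_exp_neg_half_le hβ (t := 2 * x * (1 - r)) (by positivity))
        gcongr
      have h2 : r ^ x ≤ Real.exp (-δ / 2) := by
        refine hexp.trans ?_
        gcongr
      have h3 : (2 * β) ^ β = A * (1 - Real.exp (-δ / 2)) := by rw [hA, div_mul_cancel₀ _ he.ne']
      have h4 : 0 ≤ (2 * C)⁻¹ * r ^ (2 * x) := by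
        have : 0 < r ^ (2 * x) := Real.rpow_pos_of_pos hr.1 _
        positivity
      calc (2 * x * (1 - r)) ^ β * r ^ (2 * x)
          = ((2 * x * (1 - r)) ^ β * r ^ x) * r ^ x := by rw [hr2]; ring
        _ ≤ (2 * β) ^ β * r ^ x := by gcongr
        _ = A * ((1 - Real.exp (-δ / 2)) * r ^ x) := by rw [h3]; ring
        _ ≤ A * (r ^ x - r ^ (2 * x)) := by
          gcongr
          rw [hr2]; nlinarith
        _ ≤ _ := by linarith
  refine ⟨1 + (2 * C * A)⁻¹, 2, by have : 0 < (2 * C * A)⁻¹ := by positivity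
                                   linarith, one_lt_two, fun x hx => ?_⟩
  have hx0 : 0 ≤ x := by linarith
  have hx2 : 0 ≤ 2 * x := by linarith
  have i1 := hω.integrableOn_rpow_mul hx0
  have i2 := hω.integrableOn_rpow_mul hx2
  have i3 := hω.integrableOn_rpow_mul_powerWeight hx2 hβ.le
  have i4 : IntegrableOn (fun r => r ^ x * ω r - r ^ (2 * x) * ω r) (Ioo 0 1) := i1.sub i2
  have main : (2 * x) ^ β * moment (powerWeight ω β) (2 * x)
      ≤ (2 * C)⁻¹ * moment ω (2 * x) + A * (moment ω x - moment ω (2 * x)) := by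
    rw [moment_powerWeight, moment_eq_setIntegral, moment_eq_setIntegral, ← integral_sub i1 i2,
      ← integral_const_mul, ← integral_const_mul, ← integral_const_mul,
      ← integral_add (i2.const_mul _) (i4.const_mul _)]
    refine setIntegral_mono_on (i3.const_mul _)
      ((i2.const_mul _).add (i4.const_mul _)) measurableSet_Ioo ?_
    intro r hr
    have := mul_le_mul_of_nonneg_right (pointwise x hx r hr) (hω.nonneg r ⟨hr.1.le, hr.2⟩)
    linarith
  have h2x := h (2 * x) (by linarith)
  have h9 : moment ω (2 * x) ≤ C * ((2 * C)⁻¹ * moment ω (2 * x)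
      + A * (moment ω x - moment ω (2 * x))) := by
    refine h2x.trans ?_
    rw [mul_assoc]
    gcongr
  have h10 : moment ω (2 * x) ≤ 2 * C * A * (moment ω x - moment ω (2 * x)) := by
    have : C * ((2 * C)⁻¹ * moment ω (2 * x)) = moment ω (2 * x) / 2 := by field_simp
    rw [mul_add, this] at h9
    linarith
  have h11 : (2 * C * A)⁻¹ * moment ω (2 * x) ≤ moment ω x - moment ω (2 * x) := by
    rw [inv_mul_le_iff₀ (by positivity)]
    exact h10
  linarith

end RadialBergman

/-! ### Power series against ω dA, orthogonality of monomials, dilations -/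

namespace RadialBergman

variable {ω : ℝ → ℝ}

section Taylor

/-- The Taylor coefficients at the origin. -/
noncomputable def taylorCoeff (f : ℂ → ℂ) (n : ℕ) : ℂ := (n.factorial : ℂ)⁻¹ * iteratedDeriv n f 0

lemma IsAnalyticInDisc.hasSum_taylorCoeff {f : ℂ → ℂ} (hf : IsAnalyticInDisc f) {z : ℂ}
    (hz : ‖z‖ < 1) : HasSum (fun n => taylorCoeff f n * z ^ n) (f z) := by
  have := Complex.hasSum_taylorSeries_on_ball (c := 0) (r := 1) hf (z := z) (by simpa using hz)
  refine this.congr_fun ?_ |> fun h => h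
  intro n
  simp only [taylorCoeff, smul_eq_mul, sub_zero]
  ring

lemma IsAnalyticInDisc.summable_norm_taylorCoeff {f : ℂ → ℂ} (hf : IsAnalyticInDisc f) {r : ℝ}
    (hr0 : 0 ≤ r) (hr : r < 1) : Summable fun n => ‖taylorCoeff f n‖ * r ^ n := by
  have h := (hf.hasSum_taylorCoeff (z := (r : ℂ)) (by simpa [abs_of_nonneg hr0] using hr)).summable
  refine h.norm.congr fun n => ?_
  simp [abs_of_nonneg hr0]

lemma taylorCoeff_eq_of_hasSum {f : ℂ → ℂ} (hf : IsAnalyticInDisc f) {b : ℕ → ℂ}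
    (h : ∀ z : ℂ, ‖z‖ < 1 → HasSum (fun n => b n * z ^ n) (f z)) (n : ℕ) :
    taylorCoeff f n = b n := by
  have key : ∀ c : ℕ → ℂ, (∀ z : ℂ, ‖z‖ < 1 → HasSum (fun n => c n * z ^ n) (f z)) →
      HasFPowerSeriesAt f (FormalMultilinearSeries.ofScalars ℂ c) 0 := by
    intro c hc
    rw [hasFPowerSeriesAt_iff']
    filter_upwards [isOpen_unitDisc.mem_nhds (mem_unitDisc.2 (by simp : ‖(0 : ℂ)‖ < 1))] with z hz
    simpa [FormalMultilinearSeries.coeff_ofScalars, mul_comm] using hc z (mem_unitDisc.1 hz)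
  have e := (key _ fun z hz => hf.hasSum_taylorCoeff hz).eq_formalMultilinearSeries (key b h)
  have := congrArg (fun p => FormalMultilinearSeries.coeff p n) e
  simpa [FormalMultilinearSeries.coeff_ofScalars] using this

end Taylor

section Series

lemma norm_mul_pow_le (a : ℕ → ℂ) {z : ℂ} (hz : ‖z‖ ≤ 1) (n : ℕ) :
    ‖a n * z ^ n‖ ≤ ‖a n‖ := by
  rw [norm_mul, norm_pow]
  exact mul_le_of_le_one_right (norm_nonneg _) (pow_le_one₀ (norm_nonneg _) hz)

lemma aestronglyMeasurable_of_hasSum {a : ℕ → ℂ} {F : ℂ → ℂ}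
    (hF : ∀ z : ℂ, ‖z‖ < 1 → HasSum (fun n => a n * z ^ n) (F z)) :
    AEStronglyMeasurable F (weightedMeasure ω) := by
  refine aestronglyMeasurable_of_tendsto_ae atTop
    (f := fun N z => ∑ n ∈ Finset.range N, a n * z ^ n) (fun N => ?_) ?_
  · exact Continuous.aestronglyMeasurable (by fun_prop)
  · filter_upwards [ae_norm_lt_one] with z hz
    exact (hF z hz).tendsto_sum_nat

lemma integrable_mul_of_hasSum {a : ℕ → ℂ} (ha : Summable fun n => ‖a n‖) {F k : ℂ → ℂ}
    (hF : ∀ z : ℂ, ‖z‖ < 1 → HasSum (fun n => a n * z ^ n) (F z))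
    (hk : Integrable k (weightedMeasure ω)) :
    Integrable (fun z => F z * k z) (weightedMeasure ω) := by
  refine hk.bdd_mul (c := ∑' n, ‖a n‖) (aestronglyMeasurable_of_hasSum hF) ?_
  filter_upwards [ae_norm_lt_one] with z hz
  rw [← (hF z hz).tsum_eq]
  exact tsum_of_norm_bounded ha.hasSum fun n => norm_mul_pow_le a hz.le n

lemma integrable_pow_mul {k : ℂ → ℂ} (hk : Integrable k (weightedMeasure ω)) (n : ℕ) :
    Integrable (fun z => z ^ n * k z) (weightedMeasure ω) := by
  refine hk.bdd_mul (c := 1) (Continuous.aestronglyMeasurable (by fun_prop)) ?_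
  filter_upwards [ae_norm_lt_one] with z hz
  rw [norm_pow]
  exact pow_le_one₀ (norm_nonneg _) hz.le

/-- Absolutely summable coefficients make the series uniformly convergent on the disc, so it
integrates termwise against any L^1 function. Dilated analytic functions and kernels are of this
kind. -/
lemma hasSum_integral_mul {a : ℕ → ℂ} (ha : Summable fun n => ‖a n‖) {F k : ℂ → ℂ}
    (hF : ∀ z : ℂ, ‖z‖ < 1 → HasSum (fun n => a n * z ^ n) (F z))
    (hk : Integrable k (weightedMeasure ω)) :
    HasSum (fun n => a n * ∫ z, z ^ n * k z ∂weightedMeasure ω)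
      (∫ z, F z * k z ∂weightedMeasure ω) := by
  have h1 : ∀ n, Integrable (fun z => a n * (z ^ n * k z)) (weightedMeasure ω) := fun n =>
    (integrable_pow_mul hk n).const_mul _
  have h2 : Summable fun n => ∫ z, ‖a n * (z ^ n * k z)‖ ∂weightedMeasure ω := by
    refine Summable.of_nonneg_of_le (fun n => integral_nonneg fun _ => norm_nonneg _) (fun n => ?_)
      (ha.mul_right (∫ z, ‖k z‖ ∂weightedMeasure ω))
    rw [← integral_const_mul]
    refine integral_mono_ae (h1 n).norm (hk.norm.const_mul _) ?_
    filter_upwards [ae_norm_lt_one] with z hz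
    rw [← mul_assoc, norm_mul]
    exact mul_le_mul_of_nonneg_right (norm_mul_pow_le a hz.le n) (norm_nonneg _)
  have h3 := hasSum_integral_of_summable_integral_norm h1 h2
  have h4 : ∫ z, F z * k z ∂weightedMeasure ω
      = ∫ z, ∑' n, a n * (z ^ n * k z) ∂weightedMeasure ω := by
    refine integral_congr_ae ?_
    filter_upwards [ae_norm_lt_one] with z hz
    rw [← (hF z hz).tsum_eq, ← tsum_mul_right]
    exact tsum_congr fun n => by ring
  rw [h4]
  simpa only [integral_const_mul] using h3

end Series

section Orthogonality

/-- Rotation by the angle π/(m-n) preserves the measure and changes the sign of the integrand.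
Integrability plays no role. -/
lemma integral_radial_mul_pow_mul_conj_pow_of_ne (φ : ℝ → ℂ) {m n : ℕ} (h : m ≠ n) :
    ∫ z, φ ‖z‖ * (z ^ m * conj z ^ n) ∂weightedMeasure ω = 0 := by
  set θ : ℝ := Real.pi / ((m : ℝ) - n) with hθ
  have hne : (m : ℝ) - n ≠ 0 := sub_ne_zero.2 (by exact_mod_cast h)
  set u : ℂ := Complex.exp (θ * Complex.I) with hu
  have hu1 : ‖u‖ = 1 := Complex.norm_exp_ofReal_mul_I θ
  have hrot := integral_rotation (ω := ω) hu1 (fun z : ℂ => φ ‖z‖ * (z ^ m * conj z ^ n))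
  have huv : u ^ m * conj u ^ n = -1 := by
    have hc : conj u = Complex.exp (-(θ * Complex.I)) := by
      rw [hu, ← Complex.exp_conj]; simp
    rw [hc, hu, ← Complex.exp_nat_mul, ← Complex.exp_nat_mul, ← Complex.exp_add]
    have : (m : ℂ) * (θ * Complex.I) + n * -(θ * Complex.I) = Real.pi * Complex.I := by
      have : ((m : ℝ) - n) * θ = Real.pi := by rw [hθ]; field_simp
      have h' : ((m : ℂ) - n) * (θ : ℂ) = Real.pi := by exact_mod_cast this
      rw [← h']; ring
    rw [this, Complex.exp_pi_mul_I]
  have e : ∀ z : ℂ, φ ‖u * z‖ * ((u * z) ^ m * conj (u * z) ^ n)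
      = -(φ ‖z‖ * (z ^ m * conj z ^ n)) := by
    intro z
    rw [norm_mul, hu1, one_mul, map_mul, mul_pow, mul_pow]
    linear_combination (φ ‖z‖ * (z ^ m * conj z ^ n)) * huv
  simp only [e, integral_neg] at hrot
  exact self_eq_neg.1 hrot.symm

lemma integral_pow_mul_conj_pow_of_ne {m n : ℕ} (h : m ≠ n) :
    ∫ z, z ^ m * conj z ^ n ∂weightedMeasure ω = 0 := by
  simpa using integral_radial_mul_pow_mul_conj_pow_of_ne (ω := ω) (fun _ => 1) h

lemma integral_pow_mul_conj_pow_self (n : ℕ) :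
    ∫ z, z ^ n * conj z ^ n ∂weightedMeasure ω = (normMoment ω (2 * n) : ℂ) := by
  rw [normMoment, ← integral_complex_ofReal]
  congr 1
  ext z
  rw [← mul_pow, Complex.mul_conj, Complex.normSq_eq_norm_sq]
  push_cast
  rw [pow_mul]

lemma integral_pow_mul_conj_pow (m n : ℕ) :
    ∫ z, z ^ m * conj z ^ n ∂weightedMeasure ω
      = if m = n then (normMoment ω (2 * n) : ℂ) else 0 := by
  split_ifs with h
  · rw [h, integral_pow_mul_conj_pow_self]
  · exact integral_pow_mul_conj_pow_of_ne h

lemma IsRadialWeight.integrable_conj_pow (hω : IsRadialWeight ω) (n : ℕ) :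
    Integrable (fun z : ℂ => conj z ^ n) (weightedMeasure ω) := by
  have := hω.isFiniteMeasure
  refine (MemLp.of_bound (p := 1) (Continuous.aestronglyMeasurable ?_) 1 ?_).integrable le_rfl
  · exact (Complex.continuous_conj).pow n
  filter_upwards [ae_norm_lt_one] with z hz
  simpa using pow_le_one₀ (norm_nonneg _) hz.le

end Orthogonality

section Dilation

lemma IsAnalyticInDisc.hasSum_dilation {f : ℂ → ℂ} (hf : IsAnalyticInDisc f) {r : ℝ}
    (hr : r ∈ Ioo (0 : ℝ) 1) {z : ℂ} (hz : ‖z‖ < 1) :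
    HasSum (fun n => (taylorCoeff f n * r ^ n) * z ^ n) (f (r * z)) := by
  have h : ‖(r : ℂ) * z‖ < 1 := by
    rw [norm_mul, Complex.norm_real, Real.norm_of_nonneg hr.1.le]
    nlinarith [hr.1, hr.2, norm_nonneg z]
  simpa only [mul_pow, mul_assoc] using hf.hasSum_taylorCoeff h

lemma IsAnalyticInDisc.summable_dilation {f : ℂ → ℂ} (hf : IsAnalyticInDisc f) {r : ℝ}
    (hr : r ∈ Ioo (0 : ℝ) 1) : Summable fun n => ‖taylorCoeff f n * (r : ℂ) ^ n‖ := by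
  refine (hf.summable_norm_taylorCoeff hr.1.le hr.2).congr fun n => ?_
  simp [abs_of_pos hr.1]

lemma IsAnalyticInDisc.measurable_indicator {f : ℂ → ℂ} (hf : IsAnalyticInDisc f) :
    Measurable (unitDisc.indicator f) := by
  classical
  have := ContinuousOn.measurable_piecewise (s := unitDisc) (f := f) (g := fun _ => (0 : ℂ))
    hf.continuousOn continuousOn_const measurableSet_unitDisc
  convert this using 1
  ext z
  simp [Set.indicator, Set.piecewise]

lemma norm_circleMap_zero_one (θ : ℝ) : ‖circleMap 0 1 θ‖ = 1 := by simp

/-- The Poisson formula for u ↦ f(uz) at u = r writes f(rz) as an average of f(e^{iθ}z) against a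
probability density independent of z. Tonelli and rotation invariance finish. -/
lemma lintegral_dilation_le (hω : IsRadialWeight ω) {f : ℂ → ℂ} (hf : IsAnalyticInDisc f) {r : ℝ}
    (hr : r ∈ Ioo (0 : ℝ) 1) :
    ∫⁻ z, ‖f (r * z)‖ₑ ∂weightedMeasure ω ≤ ∫⁻ z, ‖f z‖ₑ ∂weightedMeasure ω := by
  have := hω.isFiniteMeasure
  set P : ℝ → ℝ := fun θ => (2 * Real.pi)⁻¹ * ((1 - r ^ 2) / ‖circleMap 0 1 θ - r‖ ^ 2) with hP
  have hrb : (r : ℂ) ∈ Metric.ball (0 : ℂ) 1 := by simp [abs_of_pos hr.1, hr.2]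
  have hne : ∀ θ, ‖circleMap 0 1 θ - r‖ ^ 2 ≠ 0 := by
    intro θ h0
    rw [sq_eq_zero_iff, norm_eq_zero, sub_eq_zero] at h0
    have := congrArg norm h0
    simp [abs_of_pos hr.1] at this
    linarith [hr.2]
  have hPc : Continuous P := by
    rw [hP]
    refine continuous_const.mul (continuous_const.div ?_ hne)
    exact (((continuous_circleMap 0 1).sub continuous_const).norm).pow 2
  have hP0 : ∀ θ, 0 ≤ P θ := fun θ => by
    have : 0 ≤ 1 - r ^ 2 := by nlinarith [hr.1, hr.2]
    rw [hP]; positivity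
  have hpi : (0 : ℝ) ≤ 2 * Real.pi := by positivity
  have poisson : ∀ F : ℂ → ℂ, DiffContOnCl ℂ F (Metric.ball 0 1) →
      ∫ θ in Ioc 0 (2 * Real.pi), P θ • F (circleMap 0 1 θ) = F r := by
    intro F hF
    have h := hF.circleAverage_poissonKernel_smul' hrb
    rw [Real.circleAverage_def, intervalIntegral.integral_of_le hpi, ← integral_smul] at h
    rw [← h]
    refine integral_congr_ae (Eventually.of_forall fun θ => ?_)
    simp only [hP, smul_smul, sub_zero]
    congr 3
    simp [abs_of_pos hr.1]
  have hPint : ∫⁻ θ in Ioc 0 (2 * Real.pi), ENNReal.ofReal (P θ) = 1 := by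
    rw [← ofReal_integral_eq_lintegral_ofReal (hPc.integrableOn_Ioc)
      (Eventually.of_forall hP0)]
    have h := poisson (fun _ => 1) diffContOnCl_const
    have h2 : ((∫ θ in Ioc 0 (2 * Real.pi), P θ : ℝ) : ℂ) = 1 := by
      rw [← integral_complex_ofReal, ← h]
      simp
    have h3 : (∫ θ in Ioc 0 (2 * Real.pi), P θ : ℝ) = 1 := by exact_mod_cast h2
    rw [h3, ENNReal.ofReal_one]
  -- Nothing is known about f off the disc; cutting it off gives the joint measurability needed for
  -- Tonelli.
  set g := unitDisc.indicator f with hg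
  have hgm : Measurable g := hf.measurable_indicator
  have hgf : ∀ z : ℂ, ‖z‖ < 1 → g z = f z := fun z hz =>
    Set.indicator_of_mem (mem_unitDisc.2 hz) f
  have pt : ∀ z : ℂ, ‖z‖ < 1 → ‖f (r * z)‖ₑ
      ≤ ∫⁻ θ in Ioc 0 (2 * Real.pi), ENNReal.ofReal (P θ) * ‖g (circleMap 0 1 θ * z)‖ₑ := by
    intro z hz
    have hd : DiffContOnCl ℂ (fun u => f (u * z)) (Metric.ball 0 1) := by
      refine DifferentiableOn.diffContOnCl ?_
      rw [closure_ball _ one_ne_zero]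
      refine DifferentiableOn.comp hf (by fun_prop) fun u hu => ?_
      rw [mem_unitDisc, norm_mul]
      have : ‖u‖ ≤ 1 := by simpa using hu
      nlinarith [norm_nonneg z]
    have h := poisson _ hd
    rw [← h]
    refine (enorm_integral_le_lintegral_enorm _).trans (lintegral_mono fun θ => ?_)
    rw [enorm_smul, Real.enorm_of_nonneg (hP0 θ), hgf _ (by simpa using hz)]
  calc ∫⁻ z, ‖f (r * z)‖ₑ ∂weightedMeasure ω
      ≤ ∫⁻ z, (∫⁻ θ in Ioc 0 (2 * Real.pi),
          ENNReal.ofReal (P θ) * ‖g (circleMap 0 1 θ * z)‖ₑ) ∂weightedMeasure ω := by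
        refine lintegral_mono_ae ?_
        filter_upwards [ae_norm_lt_one] with z hz using pt z hz
    _ = ∫⁻ θ in Ioc 0 (2 * Real.pi), ∫⁻ z,
          ENNReal.ofReal (P θ) * ‖g (circleMap 0 1 θ * z)‖ₑ ∂weightedMeasure ω := by
        refine lintegral_lintegral_swap (Measurable.aemeasurable ?_)
        have h1 : Measurable fun p : ℂ × ℝ => ENNReal.ofReal (P p.2) :=
          (hPc.measurable.comp measurable_snd).ennreal_ofReal
        have h2 : Measurable fun p : ℂ × ℝ => circleMap 0 1 p.2 * p.1 :=
          (((continuous_circleMap 0 1).comp continuous_snd).mul continuous_fst).measurable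
        exact h1.mul (hgm.comp h2).enorm
    _ = ∫⁻ θ in Ioc 0 (2 * Real.pi), ENNReal.ofReal (P θ) * ∫⁻ z, ‖g z‖ₑ ∂weightedMeasure ω := by
        refine lintegral_congr fun θ => ?_
        have hc : ‖circleMap 0 1 θ‖ = 1 := norm_circleMap_zero_one θ
        rw [lintegral_const_mul (ENNReal.ofReal (P θ)) (f := fun z => ‖g (circleMap 0 1 θ * z)‖ₑ)
          (hgm.comp (measurable_const_mul _)).enorm]
        congr 1
        exact (measurePreserving_rotation hc).lintegral_comp_emb (measurableEmbedding_rotation hc)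
          (fun z => ‖g z‖ₑ)
    _ = ∫⁻ z, ‖g z‖ₑ ∂weightedMeasure ω := by
        rw [lintegral_mul_const _ hPc.measurable.ennreal_ofReal, hPint, one_mul]
    _ = ∫⁻ z, ‖f z‖ₑ ∂weightedMeasure ω := by
        refine lintegral_congr_ae ?_
        filter_upwards [ae_norm_lt_one] with z hz
        rw [hgf z hz]

lemma tendsto_ofReal_mul_nhdsWithin (z : ℂ) :
    Tendsto (fun r : ℝ => (r : ℂ) * z) (𝓝[<] 1) (𝓝 z) := by
  have : Continuous fun r : ℝ => (r : ℂ) * z := by fun_prop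
  simpa using (this.tendsto 1).mono_left nhdsWithin_le_nhds

lemma eventually_mem_Ioo_zero_one : ∀ᶠ r : ℝ in 𝓝[<] 1, r ∈ Ioo (0 : ℝ) 1 :=
  Ioo_mem_nhdsLT zero_lt_one

lemma IsRadialWeight.integrable_dilation (hω : IsRadialWeight ω) {f : ℂ → ℂ}
    (hf : IsAnalyticInDisc f) {r : ℝ} (hr : r ∈ Ioo (0 : ℝ) 1) :
    Integrable (fun z : ℂ => f (r * z)) (weightedMeasure ω) := by
  have := hω.isFiniteMeasure
  simpa using integrable_mul_of_hasSum (ω := ω) (hf.summable_dilation hr)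
    (fun z hz => hf.hasSum_dilation hr hz) (integrable_const (1 : ℂ))

/-- No integrable majorant of f(r·) is at hand, so dominated convergence is applied to the
difference below, and `lintegral_dilation_le` controls what was subtracted. -/
lemma tendsto_integral_norm_dilation_sub (hω : IsRadialWeight ω) {f : ℂ → ℂ}
    (hf : IsAnalyticInDisc f) (hi : Integrable f (weightedMeasure ω)) :
    Tendsto (fun r : ℝ => ∫ z, ‖f (r * z) - f z‖ ∂weightedMeasure ω) (𝓝[<] 1) (𝓝 0) := by
  -- Lies between 0 and 2|f| by the triangle inequality and tends to 0 pointwise; its integral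
  -- dominates that of |f(rz) - f(z)| because dilation does not increase the norm.
  set D : ℝ → ℂ → ℝ := fun r z => ‖f (r * z) - f z‖ - ‖f (r * z)‖ + ‖f z‖ with hD
  have hDlim : Tendsto (fun r : ℝ => ∫ z, D r z ∂weightedMeasure ω) (𝓝[<] 1)
      (𝓝 (∫ _, (0 : ℝ) ∂weightedMeasure ω)) := by
    refine tendsto_integral_filter_of_dominated_convergence (fun z => 2 * ‖f z‖) ?_ ?_
      (hi.norm.const_mul 2) ?_
    · filter_upwards [eventually_mem_Ioo_zero_one] with r hr
      have h := hω.integrable_dilation hf hr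
      exact (((h.sub hi).norm.sub h.norm).add hi.norm).aestronglyMeasurable
    · refine Eventually.of_forall fun r => Eventually.of_forall fun z => ?_
      have h1 := norm_sub_le (f (r * z)) (f z)
      have h2 := norm_sub_norm_le (f (r * z)) (f z)
      simp only [hD]
      rw [Real.norm_of_nonneg (by linarith)]
      linarith
    · filter_upwards [ae_norm_lt_one] with z hz
      have hc : ContinuousAt f z :=
        (hf.differentiableAt (isOpen_unitDisc.mem_nhds (mem_unitDisc.2 hz))).continuousAt
      have h := hc.tendsto.comp (tendsto_ofReal_mul_nhdsWithin z)
      have h' : Tendsto (fun r : ℝ => f (r * z)) (𝓝[<] 1) (𝓝 (f z)) := h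
      simpa [hD] using ((h'.sub_const (f z)).norm.sub h'.norm).add_const ‖f z‖
  rw [integral_zero] at hDlim
  refine squeeze_zero' (Eventually.of_forall fun r => integral_nonneg fun z => norm_nonneg _) ?_
    hDlim
  filter_upwards [eventually_mem_Ioo_zero_one] with r hr
  have h := hω.integrable_dilation hf hr
  have hs : Integrable (fun z => ‖f (r * z) - f z‖) (weightedMeasure ω) := (h.sub hi).norm
  have hle : ∫ z, ‖f (r * z)‖ ∂weightedMeasure ω ≤ ∫ z, ‖f z‖ ∂weightedMeasure ω := by
    rw [integral_norm_eq_lintegral_enorm h.aestronglyMeasurable,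
      integral_norm_eq_lintegral_enorm hi.aestronglyMeasurable]
    exact ENNReal.toReal_mono hi.2.ne (lintegral_dilation_le hω hf hr)
  have e : ∫ z, D r z ∂weightedMeasure ω = ∫ z, ‖f (r * z) - f z‖ ∂weightedMeasure ω
      - ∫ z, ‖f (r * z)‖ ∂weightedMeasure ω + ∫ z, ‖f z‖ ∂weightedMeasure ω := by
    rw [← integral_sub hs h.norm]
    exact integral_add (hs.sub h.norm) hi.norm
  rw [e]
  linarith

lemma tendsto_integral_dilation_mul (hω : IsRadialWeight ω) {f k : ℂ → ℂ}
    (hf : IsAnalyticInDisc f) (hi : Integrable f (weightedMeasure ω))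
    (hk : AEStronglyMeasurable k (weightedMeasure ω)) {M : ℝ}
    (hM : ∀ᵐ z ∂weightedMeasure ω, ‖k z‖ ≤ M) :
    Tendsto (fun r : ℝ => ∫ z, f (r * z) * k z ∂weightedMeasure ω) (𝓝[<] 1)
      (𝓝 (∫ z, f z * k z ∂weightedMeasure ω)) := by
  rw [tendsto_iff_norm_sub_tendsto_zero]
  have h0 : Tendsto (fun r : ℝ => M * ∫ z, ‖f (r * z) - f z‖ ∂weightedMeasure ω) (𝓝[<] 1)
      (𝓝 0) := by
    simpa using (tendsto_integral_norm_dilation_sub hω hf hi).const_mul M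
  refine squeeze_zero' (Eventually.of_forall fun r => norm_nonneg _) ?_ h0
  filter_upwards [eventually_mem_Ioo_zero_one] with r hr
  have h := hω.integrable_dilation hf hr
  rw [← integral_sub (h.mul_bdd hk hM) (hi.mul_bdd hk hM), ← integral_const_mul]
  refine norm_integral_le_of_norm_le ((h.sub hi).norm.const_mul M) ?_
  filter_upwards [hM] with z hz
  rw [← sub_mul, norm_mul, mul_comm]
  exact mul_le_mul_of_nonneg_right hz (norm_nonneg _)

end Dilation

end RadialBergman

/-! ### Coefficient formulas for the pairing, the kernel and the projection -/

namespace RadialBergman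

variable {ω : ℝ → ℝ}

lemma integral_dilation_mul_conj_pow (hω : IsRadialWeight ω) {f : ℂ → ℂ} (hf : IsAnalyticInDisc f)
    {r : ℝ} (hr : r ∈ Ioo (0 : ℝ) 1) (n : ℕ) :
    ∫ z, f (r * z) * conj z ^ n ∂weightedMeasure ω
      = taylorCoeff f n * r ^ n * normMoment ω (2 * n) := by
  have h := hasSum_integral_mul (ω := ω) (hf.summable_dilation hr)
    (fun z hz => hf.hasSum_dilation hr hz) (hω.integrable_conj_pow n)
  refine h.unique ?_
  have h2 := hasSum_single (f := fun m => taylorCoeff f m * (r : ℂ) ^ m *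
    ∫ z, z ^ m * conj z ^ n ∂weightedMeasure ω) n fun m hm => by
      rw [integral_pow_mul_conj_pow_of_ne hm, mul_zero]
  rwa [integral_pow_mul_conj_pow_self] at h2

lemma integral_mul_conj_pow (hω : IsRadialWeight ω) {f : ℂ → ℂ} (hf : IsAnalyticInDisc f)
    (hi : Integrable f (weightedMeasure ω)) (n : ℕ) :
    ∫ z, f z * conj z ^ n ∂weightedMeasure ω = taylorCoeff f n * normMoment ω (2 * n) := by
  have h1 := tendsto_integral_dilation_mul hω hf hi
    (hω.integrable_conj_pow n).aestronglyMeasurable (M := 1) (by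
      filter_upwards [ae_norm_lt_one] with z hz
      simpa using pow_le_one₀ (norm_nonneg _) hz.le)
  refine tendsto_nhds_unique h1 ?_
  have hc : Continuous fun r : ℝ => taylorCoeff f n * (r : ℂ) ^ n * normMoment ω (2 * n) := by
    fun_prop
  have h2 : Tendsto (fun r : ℝ => taylorCoeff f n * (r : ℂ) ^ n * normMoment ω (2 * n)) (𝓝[<] 1)
      (𝓝 (taylorCoeff f n * normMoment ω (2 * n))) := by
    simpa using (hc.tendsto 1).mono_left nhdsWithin_le_nhds
  refine h2.congr' ?_
  filter_upwards [eventually_mem_Ioo_zero_one] with r hr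
  exact (integral_dilation_mul_conj_pow hω hf hr n).symm

lemma integrable_conj {f : ℂ → ℂ} (hi : Integrable f (weightedMeasure ω)) :
    Integrable (fun z => conj (f z)) (weightedMeasure ω) :=
  (Complex.conjCLE.toContinuousLinearMap).integrable_comp hi

lemma integral_pow_mul_conj (f : ℂ → ℂ) (n : ℕ) :
    ∫ z, z ^ n * conj (f z) ∂weightedMeasure ω
      = conj (∫ z, f z * conj z ^ n ∂weightedMeasure ω) := by
  rw [← integral_conj]
  congr 1
  ext z
  simp [mul_comm]

/-- Only g need be integrable, as f enters through a dilation. The terms are symmetric in f and g up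
to conjugation, which is what `HasPairing.symm` uses. -/
lemma hasSum_pairing (hω : IsRadialWeight ω) {f g : ℂ → ℂ} (hf : IsAnalyticInDisc f)
    (hg : IsAnalyticInDisc g) (hgi : Integrable g (weightedMeasure ω)) {r : ℝ}
    (hr : r ∈ Ioo (0 : ℝ) 1) :
    HasSum (fun n => taylorCoeff f n * r ^ n * conj (taylorCoeff g n * normMoment ω (2 * n)))
      (∫ z, f (r * z) * conj (g z) ∂weightedMeasure ω) := by
  have h := hasSum_integral_mul (ω := ω) (hf.summable_dilation hr)
    (fun z hz => hf.hasSum_dilation hr hz) (integrable_conj hgi)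
  simpa only [integral_pow_mul_conj, integral_mul_conj_pow hω hg hgi] using h

lemma HasPairing.symm (hω : IsRadialWeight ω) {f g : ℂ → ℂ} (hf : IsAnalyticInDisc f)
    (hg : IsAnalyticInDisc g) (hfi : Integrable f (weightedMeasure ω))
    (hgi : Integrable g (weightedMeasure ω)) {L : ℂ} (h : HasPairing ω f g L) :
    HasPairing ω g f (conj L) := by
  refine ⟨fun r hr => integrable_mul_of_hasSum (hg.summable_dilation hr)
    (fun z hz => hg.hasSum_dilation hr hz) (integrable_conj hfi), ?_⟩
  have h2 := (Complex.continuous_conj.tendsto L).comp h.2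
  refine h2.congr' ?_
  filter_upwards [eventually_mem_Ioo_zero_one] with r hr
  have h3 := hasSum_pairing hω hg hf hfi hr
  have h4 := (Complex.conjCLE.toContinuousLinearMap).hasSum (hasSum_pairing hω hf hg hgi hr)
  refine HasSum.unique (f := fun n => conj (taylorCoeff f n * r ^ n *
    conj (taylorCoeff g n * normMoment ω (2 * n)))) h4 ?_
  convert h3 using 1
  ext n
  simp
  ring

section Kernel

/-- The power series of the reproducing kernel at `z`. -/
noncomputable def kernelSeries (ω : ℝ → ℝ) (z w : ℂ) : ℂ :=
  ∑' n : ℕ, ((normMoment ω (2 * n) : ℂ)⁻¹ * conj z ^ n) * w ^ n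

lemma summable_kernelSeries_coeff (hω : IsRadialWeight ω) {z : ℂ} (hz : ‖z‖ < 1) :
    Summable fun n : ℕ => ‖(normMoment ω (2 * n) : ℂ)⁻¹ * conj z ^ n‖ := by
  set ρ := (1 + ‖z‖) / 2 with hρ
  have hz0 := norm_nonneg z
  have hρI : ρ ∈ Ioo (0 : ℝ) 1 := by constructor <;> rw [hρ] <;> linarith
  obtain ⟨κ, hκ, hle⟩ := hω.exists_le_normMoment hρI
  have hρ2 : ‖z‖ < ρ ^ 2 := by rw [hρ]; nlinarith [sq_pos_of_pos (sub_pos.2 hz)]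
  have hρ0 : 0 < ρ ^ 2 := by have := hρI.1; positivity
  refine Summable.of_nonneg_of_le (fun n => norm_nonneg _) (fun n => ?_)
    ((summable_geometric_of_lt_one (r := ‖z‖ / ρ ^ 2) (by positivity)
      ((div_lt_one hρ0).2 hρ2)).mul_left κ⁻¹)
  rw [norm_mul, norm_inv, norm_pow, RCLike.norm_conj, Complex.norm_real,
    Real.norm_of_nonneg (hω.normMoment_pos _).le, div_pow, ← pow_mul]
  have h2 := hle (2 * n)
  have h3 : 0 < κ * ρ ^ (2 * n) := by have := hρI.1; positivity
  calc (normMoment ω (2 * n))⁻¹ * ‖z‖ ^ n ≤ (κ * ρ ^ (2 * n))⁻¹ * ‖z‖ ^ n := by gcongr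
    _ = _ := by rw [mul_inv]; ring

lemma hasSum_kernelSeries (hω : IsRadialWeight ω) {z w : ℂ} (hz : ‖z‖ < 1) (hw : ‖w‖ ≤ 1) :
    HasSum (fun n : ℕ => ((normMoment ω (2 * n) : ℂ)⁻¹ * conj z ^ n) * w ^ n)
      (kernelSeries ω z w) :=
  (Summable.of_norm_bounded (summable_kernelSeries_coeff hω hz)
    fun n => norm_mul_pow_le (fun n => (normMoment ω (2 * n) : ℂ)⁻¹ * conj z ^ n) hw n).hasSum

lemma hasSum_integral_mul_conj_kernelSeries (hω : IsRadialWeight ω) {h : ℂ → ℂ}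
    (hh : Integrable h (weightedMeasure ω)) {z : ℂ} (hz : ‖z‖ < 1) :
    HasSum (fun n : ℕ => (normMoment ω (2 * n) : ℂ)⁻¹ *
        (∫ ζ, h ζ * conj ζ ^ n ∂weightedMeasure ω) * z ^ n)
      (∫ ζ, h ζ * conj (kernelSeries ω z ζ) ∂weightedMeasure ω) := by
  have h1 := hasSum_integral_mul (summable_kernelSeries_coeff hω hz)
    (fun w hw => hasSum_kernelSeries hω hz hw.le) (integrable_conj hh)
  have h2 := (Complex.conjCLE.toContinuousLinearMap).hasSum h1
  convert h2 using 1
  · ext n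
    rw [integral_pow_mul_conj]
    simp
    ring
  · change _ = conj _
    rw [← integral_conj]
    congr 1
    ext ζ
    simp [mul_comm]

lemma isReproducingKernelAt_kernelSeries (hω : IsRadialWeight ω) {z : ℂ} (hz : ‖z‖ < 1) :
    IsReproducingKernelAt ω z (kernelSeries ω z) := by
  have := hω.isFiniteMeasure
  have hs := summable_kernelSeries_coeff hω hz
  refine ⟨⟨?_, ?_⟩, fun f hf => ?_⟩
  · exact Complex.differentiableOn_tsum_of_summable_norm hs (fun n => by fun_prop)
      isOpen_unitDisc fun n w hw => norm_mul_pow_le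
        (fun n => (normMoment ω (2 * n) : ℂ)⁻¹ * conj z ^ n) (mem_unitDisc.1 hw).le n
  · refine MemLp.of_bound (aestronglyMeasurable_of_hasSum
      fun w hw => hasSum_kernelSeries hω hz hw.le)
      (∑' n : ℕ, ‖(normMoment ω (2 * n) : ℂ)⁻¹ * conj z ^ n‖) ?_
    filter_upwards [ae_norm_lt_one] with w hw
    exact tsum_of_norm_bounded hs.hasSum fun n => norm_mul_pow_le
      (fun n => (normMoment ω (2 * n) : ℂ)⁻¹ * conj z ^ n) hw.le n
  · have hi : Integrable f (weightedMeasure ω) := hf.2.integrable one_le_two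
    refine HasSum.unique (hf.1.hasSum_taylorCoeff hz) ?_
    convert hasSum_integral_mul_conj_kernelSeries hω hi hz using 2 with n
    rw [integral_mul_conj_pow hω hf.1 hi]
    have : (normMoment ω (2 * n) : ℂ) ≠ 0 := by exact_mod_cast (hω.normMoment_pos _).ne'
    field_simp

/-- The chosen kernel is known only through its reproducing property. Applying that property to
`kernelSeries ω w` at z, once with each candidate kernel, gives the conjugates of both candidates at
w. -/
lemma bergmanKernel_eq (hω : IsRadialWeight ω) {z w : ℂ} (hz : ‖z‖ < 1) (hw : ‖w‖ < 1) :
    bergmanKernel ω z w = kernelSeries ω z w := by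
  have hk : IsReproducingKernelAt ω z (bergmanKernel ω z) :=
    Classical.epsilon_spec ⟨_, isReproducingKernelAt_kernelSeries hω hz⟩
  have hz' := isReproducingKernelAt_kernelSeries hω hz
  have hw' := isReproducingKernelAt_kernelSeries hω hw
  have h1 : kernelSeries ω w z = conj (bergmanKernel ω z w) := by
    rw [hk.2 _ hw'.1, hw'.2 _ hk.1, ← integral_conj]
    congr 1
    ext ζ
    simp [mul_comm]
  have h2 : kernelSeries ω w z = conj (kernelSeries ω z w) := by
    rw [hz'.2 _ hw'.1, hw'.2 _ hz'.1, ← integral_conj]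
    congr 1
    ext ζ
    simp [mul_comm]
  exact (starRingEnd ℂ).injective (h1.symm.trans h2)

lemma hasSum_bergmanProjection (hω : IsRadialWeight ω) {h : ℂ → ℂ}
    (hh : Integrable h (weightedMeasure ω)) {z : ℂ} (hz : ‖z‖ < 1) :
    HasSum (fun n : ℕ => (normMoment ω (2 * n) : ℂ)⁻¹ *
        (∫ ζ, h ζ * conj ζ ^ n ∂weightedMeasure ω) * z ^ n) (bergmanProjection ω h z) := by
  convert hasSum_integral_mul_conj_kernelSeries hω hh hz using 1
  refine integral_congr_ae ?_
  filter_upwards [ae_norm_lt_one] with ζ hζ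
  rw [bergmanKernel_eq hω hz hζ]

end Kernel

end RadialBergman

/-! ### Duality: from preimages in L^∞ to bounded pairings -/

namespace RadialBergman

variable {ω : ℝ → ℝ}

/-- The partial sum G is the orthogonal projection of h onto polynomials of degree below N, so ∫|G|²
= ∫ h conj(G) ≤ M ∫|G|. Two uses of the arithmetic-geometric mean inequality bound ∫|G| uniformly in
N. -/
lemma integral_norm_partialSum_le (hω : IsRadialWeight ω) {h : ℂ → ℂ}
    (hh : AEStronglyMeasurable h (weightedMeasure ω)) {M : ℝ}
    (hM : ∀ᵐ z ∂weightedMeasure ω, ‖h z‖ ≤ M) (N : ℕ) :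
    ∫ z, ‖∑ n ∈ Finset.range N, (normMoment ω (2 * n) : ℂ)⁻¹ *
        (∫ ζ, h ζ * conj ζ ^ n ∂weightedMeasure ω) * z ^ n‖ ∂weightedMeasure ω
      ≤ (1 + M ^ 2) * (weightedMeasure ω).real univ := by
  have := hω.isFiniteMeasure
  have hi : Integrable h (weightedMeasure ω) :=
    (MemLp.of_bound (p := 1) hh M hM).integrable le_rfl
  set H : ℕ → ℂ := fun n => ∫ ζ, h ζ * conj ζ ^ n ∂weightedMeasure ω with hH
  set b : ℕ → ℂ := fun n => (normMoment ω (2 * n) : ℂ)⁻¹ * H n with hb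
  set G : ℂ → ℂ := fun z => ∑ n ∈ Finset.range N, b n * z ^ n with hG
  have hGc : Continuous G := by rw [hG]; fun_prop
  set B : ℝ := ∑ n ∈ Finset.range N, ‖b n‖ with hB
  have hGb : ∀ᵐ z ∂weightedMeasure ω, ‖G z‖ ≤ B := by
    filter_upwards [ae_norm_lt_one] with z hz
    exact norm_sum_le_of_le _ fun n _ => norm_mul_pow_le b hz.le n
  have hbdd : ∀ {k : ℂ → ℂ} (_ : AEStronglyMeasurable k (weightedMeasure ω)) {A : ℝ}
      (_ : ∀ᵐ z ∂weightedMeasure ω, ‖k z‖ ≤ A), Integrable k (weightedMeasure ω) :=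
    fun hk _ hA => (MemLp.of_bound (p := 1) hk _ hA).integrable le_rfl
  have hGi : Integrable G (weightedMeasure ω) := hbdd hGc.aestronglyMeasurable hGb
  have hGsq : Integrable (fun z => ‖G z‖ ^ 2) (weightedMeasure ω) := by
    refine (MemLp.of_bound (p := 1) (hGc.norm.pow 2).aestronglyMeasurable (B ^ 2) ?_).integrable
      le_rfl
    filter_upwards [hGb] with z hz
    simp only [Pi.pow_apply, norm_pow, norm_norm]
    gcongr
  have expand : ∀ {k : ℂ → ℂ}, Integrable k (weightedMeasure ω) →
      ∫ z, k z * conj (G z) ∂weightedMeasure ω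
        = ∑ n ∈ Finset.range N, conj (b n) * ∫ z, k z * conj z ^ n ∂weightedMeasure ω := by
    intro k hk
    have e : ∀ z, k z * conj (G z) = ∑ n ∈ Finset.range N, conj (b n) * (k z * conj z ^ n) := by
      intro z
      rw [hG]
      simp only [map_sum, map_mul, map_pow, Finset.mul_sum]
      exact Finset.sum_congr rfl fun n _ => by ring
    simp only [e]
    rw [integral_finsetSum]
    · simp only [integral_const_mul]
    · intro n _
      refine Integrable.const_mul ?_ _
      refine hk.mul_bdd (c := 1) (hω.integrable_conj_pow n).aestronglyMeasurable ?_
      filter_upwards [ae_norm_lt_one] with z hz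
      simpa using pow_le_one₀ (norm_nonneg _) hz.le
  have hGn : ∀ n ∈ Finset.range N, ∫ z, G z * conj z ^ n ∂weightedMeasure ω = H n := by
    intro n hn
    simp only [hG, Finset.sum_mul]
    rw [integral_finsetSum]
    · simp only [mul_assoc, integral_const_mul, integral_pow_mul_conj_pow, mul_ite, mul_zero]
      rw [Finset.sum_ite_eq_of_mem' _ _ _ hn, hb]
      have : (normMoment ω (2 * n) : ℂ) ≠ 0 := by exact_mod_cast (hω.normMoment_pos _).ne'
      field_simp
    · intro m _
      simp only [mul_assoc]
      exact (integrable_pow_mul (hω.integrable_conj_pow n) m).const_mul _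
  have heq : ∫ z, G z * conj (G z) ∂weightedMeasure ω
      = ∫ z, h z * conj (G z) ∂weightedMeasure ω := by
    rw [expand hGi, expand hi]
    exact Finset.sum_congr rfl fun n hn => by rw [hGn n hn]
  set S := ∫ z, ‖G z‖ ^ 2 ∂weightedMeasure ω with hS
  set T := ∫ z, ‖G z‖ ∂weightedMeasure ω with hT
  set m := (weightedMeasure ω).real univ with hm
  have hm0 : 0 ≤ m := measureReal_nonneg
  have hS2 : (S : ℂ) = ∫ z, G z * conj (G z) ∂weightedMeasure ω := by
    rw [hS, ← integral_complex_ofReal]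
    congr 1
    ext z
    rw [Complex.mul_conj, Complex.normSq_eq_norm_sq]
  have hS0 : 0 ≤ S := integral_nonneg fun z => by positivity
  have hconst : ∀ c : ℝ, ∫ _, c ∂weightedMeasure ω = c * m := by
    intro c
    rw [integral_const, smul_eq_mul, mul_comm]
  have hST : S ≤ ∫ z, M * ‖G z‖ ∂weightedMeasure ω := by
    have : S = ‖∫ z, h z * conj (G z) ∂weightedMeasure ω‖ := by
      rw [← heq, ← hS2, Complex.norm_real, Real.norm_of_nonneg hS0]
    rw [this]
    refine norm_integral_le_of_norm_le (hGi.norm.const_mul M) ?_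
    filter_upwards [hM] with z hz
    rw [norm_mul, RCLike.norm_conj]
    gcongr
  have hSm : S ≤ M ^ 2 * m := by
    have : ∫ z, M * ‖G z‖ ∂weightedMeasure ω
        ≤ ∫ z, (M ^ 2 / 2 + ‖G z‖ ^ 2 / 2) ∂weightedMeasure ω :=
      integral_mono (hGi.norm.const_mul M) ((integrable_const _).add (hGsq.div_const 2))
        fun z => by nlinarith [sq_nonneg (M - ‖G z‖)]
    rw [integral_add (integrable_const _) (hGsq.div_const 2), hconst, integral_div] at this
    linarith
  have hTm : T ≤ ∫ z, (1 / 2 + ‖G z‖ ^ 2 / 2) ∂weightedMeasure ω :=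
    integral_mono hGi.norm ((integrable_const _).add (hGsq.div_const 2))
      fun z => by nlinarith [sq_nonneg (1 - ‖G z‖)]
  rw [integral_add (integrable_const _) (hGsq.div_const 2), hconst, integral_div] at hTm
  nlinarith

/-- Fatou's lemma applied to the partial sums. The pairing with P_ω(h) needs this integrability for
its absolute convergence. -/
lemma integrable_of_hasSum_bergmanProjection (hω : IsRadialWeight ω) {h g : ℂ → ℂ}
    (hh : AEStronglyMeasurable h (weightedMeasure ω)) {M : ℝ}
    (hM : ∀ᵐ z ∂weightedMeasure ω, ‖h z‖ ≤ M)
    (hg : ∀ z : ℂ, ‖z‖ < 1 → HasSum (fun n : ℕ => (normMoment ω (2 * n) : ℂ)⁻¹ *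
        (∫ ζ, h ζ * conj ζ ^ n ∂weightedMeasure ω) * z ^ n) (g z)) :
    Integrable g (weightedMeasure ω) := by
  refine memLp_one_iff_integrable.1 ⟨aestronglyMeasurable_of_hasSum hg, ?_⟩
  have hc : ∀ N : ℕ, Continuous fun z : ℂ => ∑ n ∈ Finset.range N, (normMoment ω (2 * n) : ℂ)⁻¹ *
        (∫ ζ, h ζ * conj ζ ^ n ∂weightedMeasure ω) * z ^ n := fun N => by fun_prop
  refine lt_of_le_of_lt (Lp.eLpNorm_le_of_ae_tendsto (u := atTop)
    (f := fun N z => ∑ n ∈ Finset.range N, (normMoment ω (2 * n) : ℂ)⁻¹ *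
        (∫ ζ, h ζ * conj ζ ^ n ∂weightedMeasure ω) * z ^ n)
    (C := ENNReal.ofReal ((1 + M ^ 2) * (weightedMeasure ω).real univ))
    (Eventually.of_forall fun N => ?_) (fun N => (hc N).aestronglyMeasurable) ?_)
    ENNReal.ofReal_lt_top
  · have := hω.isFiniteMeasure
    have hi : Integrable (fun z : ℂ => ∑ n ∈ Finset.range N, (normMoment ω (2 * n) : ℂ)⁻¹ *
        (∫ ζ, h ζ * conj ζ ^ n ∂weightedMeasure ω) * z ^ n) (weightedMeasure ω) := by
      refine integrable_finsetSum _ fun n _ => Integrable.const_mul ?_ _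
      simpa using integrable_pow_mul (integrable_const (1 : ℂ)) n
    rw [eLpNorm_one_eq_lintegral_enorm, ← ofReal_integral_norm_eq_lintegral_enorm hi]
    exact ENNReal.ofReal_le_ofReal (integral_norm_partialSum_le hω hh hM N)
  · filter_upwards [ae_norm_lt_one] with z hz
    exact (hg z hz).tendsto_sum_nat

lemma bergmanNorm_one_eq {f : ℂ → ℂ} (hf : Integrable f (weightedMeasure ω)) :
    bergmanNorm 1 ω f = ∫ z, ‖f z‖ ∂weightedMeasure ω := by
  rw [bergmanNorm, eLpNorm_one_eq_lintegral_enorm, ← ofReal_integral_norm_eq_lintegral_enorm hf,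
    ENNReal.toReal_ofReal (integral_nonneg fun _ => norm_nonneg _)]

lemma MemLinfty.ae_norm_le {h : ℂ → ℂ} (hh : MemLinfty h) :
    ∀ᵐ z ∂weightedMeasure ω, ‖h z‖ ≤ linftyNorm h := by
  refine weightedMeasure_absolutelyContinuous.ae_le ?_
  have hfin : eLpNormEssSup h areaMeasure ≠ ∞ := by
    rw [← eLpNorm_exponent_top]; exact hh.2.ne
  filter_upwards [enorm_ae_le_eLpNormEssSup h areaMeasure] with z hz
  rw [linftyNorm, eLpNorm_exponent_top, ← toReal_enorm]
  exact ENNReal.toReal_mono hfin hz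

lemma MemLinfty.aestronglyMeasurable {h : ℂ → ℂ} (hh : MemLinfty h) :
    AEStronglyMeasurable h (weightedMeasure ω) :=
  hh.1.mono_ac weightedMeasure_absolutelyContinuous

lemma MemLinfty.integrable (hω : IsRadialWeight ω) {h : ℂ → ℂ} (hh : MemLinfty h) :
    Integrable h (weightedMeasure ω) :=
  have := hω.isFiniteMeasure
  (MemLp.of_bound (p := 1) hh.aestronglyMeasurable _ hh.ae_norm_le).integrable le_rfl

/-- Pairing with a projection `P_ω(h)` of a bounded function is pairing with `h`. -/
lemma hasPairing_of_bergmanProjection_eq (hω : IsRadialWeight ω) {f g h : ℂ → ℂ}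
    (hf : MemBergman 1 ω f) (hg : IsAnalyticInDisc g) (hh : MemLinfty h)
    (hP : ∀ z ∈ unitDisc, bergmanProjection ω h z = g z) :
    HasPairing ω f g (∫ z, f z * conj (h z) ∂weightedMeasure ω) := by
  have hfi : Integrable f (weightedMeasure ω) := memLp_one_iff_integrable.1 hf.2
  have hhi := hh.integrable hω
  have hgs : ∀ z : ℂ, ‖z‖ < 1 → HasSum (fun n : ℕ => (normMoment ω (2 * n) : ℂ)⁻¹ *
        (∫ ζ, h ζ * conj ζ ^ n ∂weightedMeasure ω) * z ^ n) (g z) := fun z hz => by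
    rw [← hP z (mem_unitDisc.2 hz)]
    exact hasSum_bergmanProjection hω hhi hz
  have hgi := integrable_of_hasSum_bergmanProjection hω hh.aestronglyMeasurable hh.ae_norm_le hgs
  refine ⟨fun r hr => integrable_mul_of_hasSum (hf.1.summable_dilation hr)
    (fun z hz => hf.1.hasSum_dilation hr hz) (integrable_conj hgi), ?_⟩
  refine (tendsto_integral_dilation_mul hω hf.1 hfi (k := fun z => conj (h z))
    (integrable_conj hhi).aestronglyMeasurable (M := linftyNorm h) ?_).congr' ?_
  · filter_upwards [hh.ae_norm_le (ω := ω)] with z hz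
    rwa [RCLike.norm_conj]
  · filter_upwards [eventually_mem_Ioo_zero_one] with r hr
    -- For fixed r, pairing f(r·) with h and with g gives the same series: the coefficient of g
    -- times m_n is the n-th moment of h.
    have h1 := hasSum_integral_mul (ω := ω) (hf.1.summable_dilation hr)
      (fun z hz => hf.1.hasSum_dilation hr hz) (integrable_conj hhi)
    refine h1.unique ?_
    convert hasSum_pairing hω hf.1 hg hgi hr using 2 with n
    rw [integral_pow_mul_conj, taylorCoeff_eq_of_hasSum hg hgs]
    have : (normMoment ω (2 * n) : ℂ) ≠ 0 := by exact_mod_cast (hω.normMoment_pos _).ne'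
    congr 2
    field_simp

lemma pairing_bounded_of_bloch_subset_projection (hω : IsRadialWeight ω) {C : ℝ}
    (hC : ∀ f : ℂ → ℂ, MemBloch f → ∃ g : ℂ → ℂ, MemLinfty g ∧
      (∀ z ∈ unitDisc, bergmanProjection ω g z = f z) ∧ linftyNorm g ≤ C * blochNorm f)
    {f g : ℂ → ℂ} (hf : MemBergman 1 ω f) (hg : MemBloch g) :
    ∃ L : ℂ, HasPairing ω f g L ∧ ‖L‖ ≤ C * blochNorm g * bergmanNorm 1 ω f := by
  obtain ⟨h, hh, hP, hle⟩ := hC g hg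
  have hfi : Integrable f (weightedMeasure ω) := memLp_one_iff_integrable.1 hf.2
  refine ⟨_, hasPairing_of_bergmanProjection_eq hω hf hg.1 hh hP, ?_⟩
  rw [bergmanNorm_one_eq hfi]
  calc ‖∫ z, f z * conj (h z) ∂weightedMeasure ω‖
      ≤ ∫ z, linftyNorm h * ‖f z‖ ∂weightedMeasure ω := by
        refine norm_integral_le_of_norm_le (hfi.norm.const_mul _) ?_
        filter_upwards [hh.ae_norm_le (ω := ω)] with z hz
        rw [norm_mul, RCLike.norm_conj, mul_comm]
        gcongr
    _ = linftyNorm h * ∫ z, ‖f z‖ ∂weightedMeasure ω := integral_const_mul _ _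
    _ ≤ _ := mul_le_mul_of_nonneg_right hle (integral_nonneg fun _ => norm_nonneg _)

lemma MemLittleBloch.memBloch {g : ℂ → ℂ} (hg : MemLittleBloch g) : MemBloch g := by
  refine ⟨hg.1, ?_⟩
  have h1 : ∀ᶠ z in comap (fun z : ℂ => ‖z‖) (𝓝[<] 1), blochDensity g z < 1 :=
    hg.2.eventually_lt_const one_pos
  rw [eventually_comap] at h1
  obtain ⟨ρ, hρ, hρ1⟩ := (mem_nhdsLT_iff_exists_Ioo_subset.1 h1)
  have hρlt : ρ < 1 := hρ
  have hcont : ContinuousOn (blochDensity g) (Metric.closedBall 0 ρ) := by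
    have hd : ContinuousOn (deriv g) unitDisc := (hg.1.deriv isOpen_unitDisc).continuousOn
    have hsub : Metric.closedBall (0 : ℂ) ρ ⊆ unitDisc := Metric.closedBall_subset_ball hρlt
    exact (hd.mono hsub).norm.mul (by fun_prop)
  obtain ⟨B, hB⟩ := (isCompact_closedBall (0 : ℂ) ρ).bddAbove_image hcont
  refine ⟨max B 1, ?_⟩
  rintro _ ⟨z, hz, rfl⟩
  by_cases hzρ : ‖z‖ ≤ ρ
  · exact le_max_of_le_left (hB ⟨z, by simpa using hzρ, rfl⟩)
  · push Not at hzρ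
    exact le_max_of_le_right (hρ1 ⟨hzρ, mem_unitDisc.1 hz⟩ z rfl).le

lemma littleBloch_pairing_bounded (hω : IsRadialWeight ω) {C : ℝ}
    (hC : ∀ f g : ℂ → ℂ, MemBergman 1 ω f → MemBloch g →
      ∃ L : ℂ, HasPairing ω f g L ∧ ‖L‖ ≤ C * blochNorm g * bergmanNorm 1 ω f)
    {f g : ℂ → ℂ} (hf : MemBergman 1 ω f) (hg : MemLittleBloch g) :
    ∃ L : ℂ, HasPairing ω g f L ∧ ‖L‖ ≤ C * blochNorm g * bergmanNorm 1 ω f := by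
  have := hω.isFiniteMeasure
  -- Pairing the constant 1 with g forces absolute convergence of ∫ g ω dA, which puts g in L^1.
  have hone : MemBergman 1 ω fun _ => 1 := ⟨differentiableOn_const _, memLp_const 1⟩
  obtain ⟨_, h1, _⟩ := hC _ g hone hg.memBloch
  have hgi : Integrable g (weightedMeasure ω) := by
    have h2 := integrable_conj (h1.1 (1 / 2) (by norm_num))
    simpa using h2
  obtain ⟨L, hL, hLC⟩ := hC f g hf hg.memBloch
  refine ⟨conj L, hL.symm hω hf.1 hg.1 (memLp_one_iff_integrable.1 hf.2) hgi, ?_⟩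
  rwa [RCLike.norm_conj]

end RadialBergman

/-! ### Lacunary test polynomials: from bounded pairings to the class 𝓜 -/

namespace RadialBergman

variable {ω : ℝ → ℝ}

/-- The sum of the monomials `z ^ m j`, `j < N`. -/
def monomialSum (m : ℕ → ℕ) (N : ℕ) (z : ℂ) : ℂ := ∑ j ∈ Finset.range N, z ^ m j

lemma continuous_monomialSum (m : ℕ → ℕ) (N : ℕ) : Continuous (monomialSum m N) := by
  unfold monomialSum; fun_prop

lemma differentiable_monomialSum (m : ℕ → ℕ) (N : ℕ) : Differentiable ℂ (monomialSum m N) := by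
  unfold monomialSum; fun_prop

lemma norm_monomialSum_le (m : ℕ → ℕ) (N : ℕ) {z : ℂ} (hz : ‖z‖ ≤ 1) :
    ‖monomialSum m N z‖ ≤ N := by
  refine (norm_sum_le_of_le (f := fun j => z ^ m j) (n := fun _ => 1) _ fun j _ => ?_).trans
    (by simp)
  rw [norm_pow]
  exact pow_le_one₀ (norm_nonneg _) hz

lemma IsRadialWeight.integrable_monomialSum (hω : IsRadialWeight ω) (m : ℕ → ℕ) (N : ℕ) :
    Integrable (monomialSum m N) (weightedMeasure ω) := by
  have := hω.isFiniteMeasure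
  refine (MemLp.of_bound (p := 1) (continuous_monomialSum m N).aestronglyMeasurable N
    ?_).integrable le_rfl
  filter_upwards [ae_norm_lt_one] with z hz using norm_monomialSum_le m N hz.le

lemma integral_monomialSum_mul_conj (hω : IsRadialWeight ω) {m : ℕ → ℕ}
    (hm : Function.Injective m) (N : ℕ) :
    ∫ z, monomialSum m N z * conj (monomialSum m N z) ∂weightedMeasure ω
      = ((∑ j ∈ Finset.range N, normMoment ω (2 * m j) : ℝ) : ℂ) := by
  have e : ∀ z, monomialSum m N z * conj (monomialSum m N z)
      = ∑ i ∈ Finset.range N, ∑ j ∈ Finset.range N, z ^ m i * conj z ^ m j := by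
    intro z
    simp only [monomialSum, map_sum, map_pow, Finset.sum_mul_sum]
  have hi : ∀ i j, Integrable (fun z : ℂ => z ^ m i * conj z ^ m j) (weightedMeasure ω) :=
    fun i j => integrable_pow_mul (hω.integrable_conj_pow _) _
  simp only [e]
  rw [integral_finsetSum _ fun i _ => integrable_finsetSum _ fun j _ => hi i j]
  push_cast
  refine Finset.sum_congr rfl fun i hi' => ?_
  rw [integral_finsetSum _ fun j _ => hi i j]
  simp only [integral_pow_mul_conj_pow, hm.eq_iff]
  rw [Finset.sum_ite_eq, if_pos hi']

lemma integral_norm_monomialSum_sq (hω : IsRadialWeight ω) {m : ℕ → ℕ}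
    (hm : Function.Injective m) (N : ℕ) :
    ∫ z, ‖monomialSum m N z‖ ^ 2 ∂weightedMeasure ω
      = ∑ j ∈ Finset.range N, normMoment ω (2 * m j) := by
  have h := integral_monomialSum_mul_conj hω hm N
  have e : ∀ z, monomialSum m N z * conj (monomialSum m N z)
      = ((‖monomialSum m N z‖ ^ 2 : ℝ) : ℂ) := by
    intro z
    rw [Complex.mul_conj, Complex.normSq_eq_norm_sq]
  simp only [e, integral_complex_ofReal] at h
  exact_mod_cast h

lemma injective_two_pow_mul {t : ℕ} (ht : 1 ≤ t) :
    Function.Injective fun j : ℕ => 2 ^ (j + 1) * t := by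
  intro i j h
  have h2 : 2 ^ (i + 1) = 2 ^ (j + 1) := Nat.eq_of_mul_eq_mul_right (by omega) h
  have := Nat.pow_right_injective le_rfl h2
  omega

/-- Cauchy–Schwarz after extracting z^t: the factor z^t and each remaining monomial have squared
norm at most m_t, so s² terms cost only s m_t. -/
lemma integral_norm_lacunary_le (hω : IsRadialWeight ω) {t s : ℕ} (ht : 1 ≤ t) (hs : 1 ≤ s) :
    ∫ z, ‖monomialSum (fun j => 2 ^ (j + 1) * t) (s ^ 2) z‖ ∂weightedMeasure ω
      ≤ s * normMoment ω (2 * t) := by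
  have := hω.isFiniteMeasure
  set m : ℕ → ℕ := fun j => 2 ^ (j + 1) * t with hm
  -- All exponents are at least 2t, so at least t remains after the extraction.
  set m' : ℕ → ℕ := fun j => 2 ^ (j + 1) * t - t with hm'
  have hmm : ∀ j, m j = t + m' j := by
    intro j
    simp only [hm, hm']
    have : t ≤ 2 ^ (j + 1) * t := Nat.le_mul_of_pos_left _ (by positivity)
    omega
  have hle : ∀ j, t ≤ m' j := by
    intro j
    simp only [hm']
    have : 2 * t ≤ 2 ^ (j + 1) * t := by
      rw [pow_succ]
      have : 1 ≤ 2 ^ j := Nat.one_le_two_pow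
      nlinarith
    omega
  have hinj : Function.Injective m' := by
    intro i j h
    refine injective_two_pow_mul ht (?_ : m i = m j)
    rw [hmm, hmm, h]
  have hfac : ∀ z, monomialSum m (s ^ 2) z = z ^ t * monomialSum m' (s ^ 2) z := by
    intro z
    simp only [monomialSum, Finset.mul_sum, hmm, pow_add]
  have hs0 : (0 : ℝ) < s := by exact_mod_cast hs
  have hsq : Integrable (fun z => ‖monomialSum m' (s ^ 2) z‖ ^ 2) (weightedMeasure ω) := by
    refine (MemLp.of_bound (p := 1) ((continuous_monomialSum _ _).norm.pow 2).aestronglyMeasurable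
      (((s ^ 2 : ℕ) : ℝ) ^ 2) ?_).integrable le_rfl
    filter_upwards [ae_norm_lt_one] with z hz
    have := norm_monomialSum_le m' (s ^ 2) hz.le
    simp only [Pi.pow_apply, norm_pow, norm_norm]
    gcongr
  have hpow : Integrable (fun z : ℂ => ‖z‖ ^ (2 * t)) (weightedMeasure ω) := by
    simpa using (integrable_pow_mul (integrable_const (1 : ℂ)) (2 * t)).norm
  have pt : ∀ z : ℂ, ‖monomialSum m (s ^ 2) z‖
      ≤ ‖monomialSum m' (s ^ 2) z‖ ^ 2 * (2 * s : ℝ)⁻¹ + ‖z‖ ^ (2 * t) * (s / 2) := by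
    intro z
    rw [hfac, norm_mul, norm_pow, mul_comm 2 t, pow_mul]
    set A := ‖monomialSum m' (s ^ 2) z‖
    set B := ‖z‖ ^ t
    have : A ^ 2 * (2 * s : ℝ)⁻¹ + B ^ 2 * (s / 2) - B * A = (A - s * B) ^ 2 * (2 * s : ℝ)⁻¹ := by
      field_simp
      ring
    have h2 : 0 ≤ (A - s * B) ^ 2 * (2 * s : ℝ)⁻¹ := by positivity
    linarith
  have h1 := integral_mono (hω.integrable_monomialSum m (s ^ 2)).norm
    ((hsq.mul_const _).add (hpow.mul_const _)) pt
  refine h1.trans ?_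
  rw [integral_add' (hsq.mul_const _) (hpow.mul_const _), integral_mul_const, integral_mul_const,
    integral_norm_monomialSum_sq hω hinj]
  have h2 : ∑ j ∈ Finset.range (s ^ 2), normMoment ω (2 * m' j)
      ≤ (s : ℝ) ^ 2 * normMoment ω (2 * t) := by
    refine (Finset.sum_le_card_nsmul _ _ _ fun j _ =>
      hω.normMoment_antitone (Nat.mul_le_mul_left 2 (hle j))).trans ?_
    simp
  calc _ ≤ (s : ℝ) ^ 2 * normMoment ω (2 * t) * (2 * s : ℝ)⁻¹ + normMoment ω (2 * t) * (s / 2) := by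
        gcongr
        exact le_rfl
    _ = s * normMoment ω (2 * t) := by field_simp; ring

/-- Each term n ρ^(n-1) is at most twice the sum of ρ^k over the dyadic block n/2 ≤ k < n (over all
k < y for the first term), and these blocks are disjoint. -/
lemma sum_lacunary_mul_pow_le {y : ℕ} (hy : 1 ≤ y) {ρ : ℝ} (hρ0 : 0 ≤ ρ) (hρ1 : ρ ≤ 1) (N : ℕ) :
    ∑ j ∈ Finset.range (N + 1), ((2 ^ j * y : ℕ) : ℝ) * ρ ^ (2 ^ j * y - 1)
      ≤ 2 * ∑ k ∈ Finset.range (2 ^ N * y), ρ ^ k := by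
  have block : ∀ a b : ℕ, a < b → ((b - a : ℕ) : ℝ) * ρ ^ (b - 1) ≤ ∑ k ∈ Finset.Ico a b, ρ ^ k := by
    intro a b hab
    have := Finset.card_nsmul_le_sum (Finset.Ico a b) (fun k => ρ ^ k) (ρ ^ (b - 1))
      fun k hk => pow_le_pow_of_le_one hρ0 hρ1 (by rw [Finset.mem_Ico] at hk; omega)
    simpa using this
  induction N with
  | zero =>
    have h := block 0 y (by omega)
    rw [← Finset.range_eq_Ico] at h
    have h0 : 0 ≤ ∑ k ∈ Finset.range y, ρ ^ k := Finset.sum_nonneg fun k _ => by positivity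
    simp only [Nat.sub_zero] at h
    simp
    linarith
  | succ N ih =>
    have hpos : 0 < 2 ^ N * y := by positivity
    have e : 2 ^ (N + 1) * y = 2 * (2 ^ N * y) := by ring
    have h := block (2 ^ N * y) (2 ^ (N + 1) * y) (by omega)
    rw [Finset.sum_range_succ, ← Finset.sum_range_add_sum_Ico _ (by omega :
      2 ^ N * y ≤ 2 ^ (N + 1) * y)]
    have e2 : 2 ^ (N + 1) * y - 2 ^ N * y = 2 ^ N * y := by omega
    rw [e2] at h
    have e3 : ((2 ^ (N + 1) * y : ℕ) : ℝ) = 2 * ((2 ^ N * y : ℕ) : ℝ) := by exact_mod_cast e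
    rw [e3]
    linarith

lemma deriv_monomialSum (m : ℕ → ℕ) (N : ℕ) (z : ℂ) :
    deriv (monomialSum m N) z = ∑ j ∈ Finset.range N, (m j : ℂ) * z ^ (m j - 1) := by
  have : HasDerivAt (monomialSum m N) (∑ j ∈ Finset.range N, (m j : ℂ) * z ^ (m j - 1)) z :=
    HasDerivAt.fun_sum fun j _ => hasDerivAt_pow (m j) z
  exact this.deriv

lemma norm_deriv_monomialSum_le (m : ℕ → ℕ) (N : ℕ) (z : ℂ) :
    ‖deriv (monomialSum m N) z‖ ≤ ∑ j ∈ Finset.range N, (m j : ℝ) * ‖z‖ ^ (m j - 1) := by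
  rw [deriv_monomialSum]
  exact norm_sum_le_of_le _ fun j _ => by simp

lemma blochDensity_lacunary_le {y : ℕ} (hy : 1 ≤ y) (N : ℕ) {z : ℂ} (hz : ‖z‖ < 1) :
    blochDensity (monomialSum (fun j => 2 ^ j * y) N) z ≤ 4 := by
  have h0 := norm_nonneg z
  have h1 : ‖deriv (monomialSum (fun j => 2 ^ j * y) N) z‖
      ≤ 2 * ∑ k ∈ Finset.range (2 ^ N * y), ‖z‖ ^ k := by
    refine (norm_deriv_monomialSum_le _ N z).trans
      (le_trans ?_ (sum_lacunary_mul_pow_le hy h0 hz.le N))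
    exact Finset.sum_le_sum_of_subset_of_nonneg (Finset.range_mono (Nat.le_succ N))
      fun j _ _ => by positivity
  have h2 : (∑ k ∈ Finset.range (2 ^ N * y), ‖z‖ ^ k) * (1 - ‖z‖) ≤ 1 := by
    rw [geom_sum_mul_neg]
    have : 0 ≤ ‖z‖ ^ (2 ^ N * y) := by positivity
    linarith
  have h3 : 0 ≤ 1 - ‖z‖ ^ 2 := by nlinarith
  calc blochDensity (monomialSum (fun j => 2 ^ j * y) N) z
      ≤ (2 * ∑ k ∈ Finset.range (2 ^ N * y), ‖z‖ ^ k) * (1 - ‖z‖ ^ 2) :=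
        mul_le_mul_of_nonneg_right h1 h3
    _ = 2 * ((∑ k ∈ Finset.range (2 ^ N * y), ‖z‖ ^ k) * (1 - ‖z‖)) * (1 + ‖z‖) := by ring
    _ ≤ 2 * 1 * (1 + 1) := by gcongr
    _ = 4 := by norm_num

lemma memLittleBloch_monomialSum (m : ℕ → ℕ) (N : ℕ) : MemLittleBloch (monomialSum m N) := by
  refine ⟨(differentiable_monomialSum m N).differentiableOn, ?_⟩
  set B : ℝ := ∑ j ∈ Finset.range N, (m j : ℝ) with hB
  have hlim : Tendsto (fun z : ℂ => B * (1 - ‖z‖ ^ 2)) (comap (fun z : ℂ => ‖z‖) (𝓝[<] 1))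
      (𝓝 0) := by
    have hc : Continuous fun r : ℝ => B * (1 - r ^ 2) := by fun_prop
    have h := ((hc.tendsto 1).mono_left (nhdsWithin_le_nhds (s := Iio 1)))
    have h' := h.comp (tendsto_comap (f := fun z : ℂ => ‖z‖))
    simpa [Function.comp_def] using h'
  have hlt : ∀ᶠ z in comap (fun z : ℂ => ‖z‖) (𝓝[<] 1), ‖z‖ < 1 :=
    tendsto_comap.eventually (eventually_mem_nhdsWithin (a := (1 : ℝ)) (s := Iio 1))
  refine squeeze_zero' ?_ ?_ hlim
  · filter_upwards [hlt] with z hz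
    have := norm_nonneg z
    exact mul_nonneg (norm_nonneg _) (by nlinarith)
  · filter_upwards [hlt] with z hz
    have h0 := norm_nonneg z
    refine mul_le_mul_of_nonneg_right ((norm_deriv_monomialSum_le m N z).trans ?_) (by nlinarith)
    exact Finset.sum_le_sum fun j _ =>
      mul_le_of_le_one_right (Nat.cast_nonneg _) (pow_le_one₀ h0 hz.le)

lemma blochNorm_lacunary_le {y : ℕ} (hy : 1 ≤ y) (N : ℕ) :
    blochNorm (monomialSum (fun j => 2 ^ j * y) N) ≤ 4 := by
  have h0 : monomialSum (fun j => 2 ^ j * y) N 0 = 0 :=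
    Finset.sum_eq_zero fun j _ => zero_pow (by positivity)
  rw [blochNorm, h0, norm_zero, add_zero]
  refine csSup_le (Set.Nonempty.image _ ⟨0, mem_unitDisc.2 (by simp)⟩) ?_
  rintro _ ⟨z, hz, rfl⟩
  exact blochDensity_lacunary_le hy N (mem_unitDisc.1 hz)

lemma hasPairing_monomialSum (hω : IsRadialWeight ω) {m : ℕ → ℕ} (hm : Function.Injective m)
    (N : ℕ) {L : ℂ} (hL : HasPairing ω (monomialSum m N) (monomialSum m N) L) :
    L = ((∑ j ∈ Finset.range N, normMoment ω (2 * m j) : ℝ) : ℂ) := by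
  have h := tendsto_integral_dilation_mul hω
    (differentiable_monomialSum m N).differentiableOn (hω.integrable_monomialSum m N)
    (integrable_conj (hω.integrable_monomialSum m N)).aestronglyMeasurable (M := N) (by
      filter_upwards [ae_norm_lt_one] with z hz
      rw [RCLike.norm_conj]
      exact norm_monomialSum_le m N hz.le)
  rw [integral_monomialSum_mul_conj hω hm] at h
  exact tendsto_nhds_unique hL.2 h

/-- With f = g the lacunary polynomial, s² m_N ≤ Σ m_n ≤ 4C · s m_t, where N = 2^(s²) t is the
largest exponent. The choice s ≥ 8C gives 2 m_N ≤ m_t. -/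
lemma classM_of_littleBloch_pairing_bounded (hω : IsRadialWeight ω) {C : ℝ} (hC0 : 0 < C)
    (hC : ∀ f g : ℂ → ℂ, MemBergman 1 ω f → MemLittleBloch g →
      ∃ L : ℂ, HasPairing ω g f L ∧ ‖L‖ ≤ C * blochNorm g * bergmanNorm 1 ω f) :
    ClassM ω := by
  obtain ⟨s, hs⟩ := exists_nat_ge (8 * C)
  have hs0 : (0 : ℝ) < s := by linarith
  have hs1 : 1 ≤ s := by exact_mod_cast hs0
  have key : ∀ t : ℕ, 1 ≤ t →
      2 * normMoment ω (2 ^ (s ^ 2 + 1) * t) ≤ normMoment ω (2 * t) := by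
    intro t ht
    set m : ℕ → ℕ := fun j => 2 ^ (j + 1) * t with hm
    have hinj : Function.Injective m := injective_two_pow_mul ht
    have hm2 : m = fun j => 2 ^ j * (2 * t) := by
      ext j; simp only [hm]; ring
    have hi := hω.integrable_monomialSum m (s ^ 2)
    obtain ⟨L, hL, hle⟩ := hC _ _ ⟨(differentiable_monomialSum m (s ^ 2)).differentiableOn,
      memLp_one_iff_integrable.2 hi⟩ (memLittleBloch_monomialSum m (s ^ 2))
    rw [hasPairing_monomialSum hω hinj _ hL, Complex.norm_real, bergmanNorm_one_eq hi,
      Real.norm_of_nonneg (Finset.sum_nonneg fun j _ => (hω.normMoment_pos _).le)] at hle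
    have h1 : (s : ℝ) ^ 2 * normMoment ω (2 ^ (s ^ 2 + 1) * t)
        ≤ ∑ j ∈ Finset.range (s ^ 2), normMoment ω (2 * m j) := by
      have := Finset.card_nsmul_le_sum (Finset.range (s ^ 2)) (fun j => normMoment ω (2 * m j))
        (normMoment ω (2 ^ (s ^ 2 + 1) * t)) fun j hj => by
          refine hω.normMoment_antitone ?_
          have h2 : 2 ^ (j + 1) ≤ 2 ^ (s ^ 2) :=
            Nat.pow_le_pow_right two_pos (Finset.mem_range.1 hj)
          simp only [hm]
          rw [pow_succ 2 (s ^ 2)]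
          nlinarith
      simpa using this
    have h2 : blochNorm (monomialSum m (s ^ 2)) ≤ 4 := by
      rw [hm2]; exact blochNorm_lacunary_le (by omega) _
    have h3 := integral_norm_lacunary_le hω ht hs1
    have h4 : (s : ℝ) ^ 2 * normMoment ω (2 ^ (s ^ 2 + 1) * t)
        ≤ C * 4 * (s * normMoment ω (2 * t)) := by
      refine (h1.trans hle).trans ?_
      have h5 : 0 ≤ ∫ z, ‖monomialSum m (s ^ 2) z‖ ∂weightedMeasure ω :=
        integral_nonneg fun _ => norm_nonneg _
      have h6 := (hω.normMoment_pos (2 * t)).le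
      calc _ ≤ C * 4 * ∫ z, ‖monomialSum m (s ^ 2) z‖ ∂weightedMeasure ω := by gcongr
        _ ≤ _ := by gcongr
    have h7 : s * normMoment ω (2 ^ (s ^ 2 + 1) * t) ≤ 4 * C * normMoment ω (2 * t) := by
      have : s * (s * normMoment ω (2 ^ (s ^ 2 + 1) * t))
          ≤ s * (4 * C * normMoment ω (2 * t)) := by linarith
      exact le_of_mul_le_mul_left this hs0
    have h8 : 4 * C * normMoment ω (2 * t) ≤ s / 2 * normMoment ω (2 * t) := by
      have := (hω.normMoment_pos (2 * t)).le
      gcongr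
      linarith
    have h9 : s * (2 * normMoment ω (2 ^ (s ^ 2 + 1) * t)) ≤ s * normMoment ω (2 * t) := by
      linarith
    exact le_of_mul_le_mul_left h9 hs0
  -- With t = ⌈x/2⌉ one has 2t ≤ x + 2 ≤ 3x, which explains the 3; the extra 1 covers the exponent
  -- shift in `normMoment_eq`.
  refine ⟨2, 3 * 2 ^ (s ^ 2) + 1, one_lt_two, ?_, fun x hx => ?_⟩
  · have : (0 : ℝ) < 2 ^ (s ^ 2) := by positivity
    linarith
  · set t := ⌈x / 2⌉₊ with ht
    have ht1 : 1 ≤ t := Nat.one_le_ceil_iff.2 (by linarith)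
    have hxt : x / 2 ≤ t := Nat.le_ceil _
    have htx : (t : ℝ) < x / 2 + 1 := Nat.ceil_lt_add_one (by linarith)
    have h := key t ht1
    rw [hω.normMoment_eq, hω.normMoment_eq] at h
    have hp : (0 : ℝ) < 2 ^ (s ^ 2) := by positivity
    have h1 : moment ω (((2 * t : ℕ) : ℝ) + 1) ≤ moment ω x := by
      refine hω.moment_antitone (by linarith) ?_
      push_cast
      linarith
    have h2 : moment ω ((3 * 2 ^ (s ^ 2) + 1) * x)
        ≤ moment ω (((2 ^ (s ^ 2 + 1) * t : ℕ) : ℝ) + 1) := by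
      refine hω.moment_antitone (by positivity) ?_
      push_cast
      rw [pow_succ]
      nlinarith
    linarith

end RadialBergman

/-! ### Multipliers of polynomials with frequencies in [a, b] on the circle -/

namespace RadialBergman

section CircleMultipliers

variable {c : ℕ → ℂ} {a b : ℕ} {A : ℝ}

/-- Maximum principle for the polynomial divided by z^a. -/
lemma norm_dilation_le_of_norm_le_on_circle
    (hA : ∀ w : ℂ, ‖w‖ = 1 → ‖∑ n ∈ Finset.Icc a b, c n * w ^ n‖ ≤ A) {t : ℝ} (ht0 : 0 ≤ t)
    (ht1 : t ≤ 1) {w : ℂ} (hw : ‖w‖ = 1) :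
    ‖∑ n ∈ Finset.Icc a b, c n * (t * w) ^ n‖ ≤ t ^ a * A := by
  set Q : ℂ → ℂ := fun z => ∑ n ∈ Finset.Icc a b, c n * z ^ (n - a) with hQ
  have hfac : ∀ z : ℂ, ∑ n ∈ Finset.Icc a b, c n * z ^ n = z ^ a * Q z := by
    intro z
    rw [hQ, Finset.mul_sum]
    refine Finset.sum_congr rfl fun n hn => ?_
    rw [mul_left_comm, ← pow_add, Nat.add_sub_cancel' (Finset.mem_Icc.1 hn).1]
  have hQd : Differentiable ℂ Q := by rw [hQ]; fun_prop
  have hQA : ‖Q (t * w)‖ ≤ A := by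
    refine Complex.norm_le_of_forall_mem_frontier_norm_le (U := Metric.ball 0 1)
      Metric.isBounded_ball hQd.diffContOnCl (fun z hz => ?_) ?_
    · rw [frontier_ball _ one_ne_zero, mem_sphere_zero_iff_norm] at hz
      have := hA z hz
      rwa [hfac, norm_mul, norm_pow, hz, one_pow, one_mul] at this
    · rw [closure_ball _ one_ne_zero]
      simpa [hw, abs_of_nonneg ht0] using ht1
  rw [hfac, norm_mul, norm_pow, norm_mul, hw, mul_one, Complex.norm_real, Real.norm_of_nonneg ht0]
  gcongr

/-- Moving out to radius 1/t costs t^(-b): maximum principle for the reversed polynomial z^b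
conj(P(1/conj z)). -/
lemma norm_inv_dilation_le_of_norm_le_on_circle
    (hA : ∀ w : ℂ, ‖w‖ = 1 → ‖∑ n ∈ Finset.Icc a b, c n * w ^ n‖ ≤ A) {t : ℝ} (ht0 : 0 < t)
    (ht1 : t ≤ 1) {w : ℂ} (hw : ‖w‖ = 1) :
    ‖∑ n ∈ Finset.Icc a b, c n * ((t : ℂ)⁻¹ * w) ^ n‖ ≤ (t⁻¹) ^ b * A := by
  set R : ℂ → ℂ := fun z => ∑ n ∈ Finset.Icc a b, conj (c n) * z ^ (b - n) with hR
  have ht : (t : ℂ) ≠ 0 := by exact_mod_cast ht0.ne'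
  have hw' : w * conj w = 1 := by
    rw [Complex.mul_conj, Complex.normSq_eq_norm_sq, hw]; simp
  have hrev : ∀ (s : ℝ) (w : ℂ), s ≠ 0 → w * conj w = 1 → R (s * w)
      = (s * w) ^ b * conj (∑ n ∈ Finset.Icc a b, c n * ((s : ℂ)⁻¹ * w) ^ n) := by
    intro s w hs hw
    rw [hR, map_sum, Finset.mul_sum]
    refine Finset.sum_congr rfl fun n hn => ?_
    have hs' : (s : ℂ) ≠ 0 := by exact_mod_cast hs
    have e : (s * w) ^ b = (s * w) ^ (b - n) * (s * w) ^ n := by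
      rw [← pow_add, Nat.sub_add_cancel (Finset.mem_Icc.1 hn).2]
    have e2 : (s * w) ^ n * ((s : ℂ)⁻¹ * conj w) ^ n = 1 := by
      rw [← mul_pow]
      have : s * w * ((s : ℂ)⁻¹ * conj w) = 1 := by
        field_simp
        exact hw
      rw [this, one_pow]
    rw [map_mul, map_pow, map_mul, map_inv₀, Complex.conj_ofReal, e]
    linear_combination -(conj (c n) * (s * w) ^ (b - n)) * e2
  have hRd : Differentiable ℂ R := by rw [hR]; fun_prop
  have hRA : ‖R (t * w)‖ ≤ A := by
    refine Complex.norm_le_of_forall_mem_frontier_norm_le (U := Metric.ball 0 1)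
      Metric.isBounded_ball hRd.diffContOnCl (fun z hz => ?_) ?_
    · rw [frontier_ball _ one_ne_zero, mem_sphere_zero_iff_norm] at hz
      have hz' : z * conj z = 1 := by
        rw [Complex.mul_conj, Complex.normSq_eq_norm_sq, hz]; simp
      have h := hrev 1 z one_ne_zero hz'
      simp only [Complex.ofReal_one, one_mul, inv_one] at h
      rw [h, norm_mul, norm_pow, hz, one_pow, one_mul, RCLike.norm_conj]
      exact hA z hz
    · rw [closure_ball _ one_ne_zero]
      simpa [hw, abs_of_pos ht0] using ht1
  rw [hrev t w ht0.ne' hw', norm_mul, norm_pow, norm_mul, hw, mul_one, Complex.norm_real,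
    Real.norm_of_nonneg ht0.le, RCLike.norm_conj] at hRA
  rw [inv_pow, le_inv_mul_iff₀ (by positivity)]
  exact hRA

/-- A moment sequence ∫ τ^n acts as an average of inward dilations. It is used with τ = e^(-x),
giving 1/n, and with τ = |z|², giving m_n. -/
lemma norm_multiplier_le_of_norm_le_on_circle {α : Type*} [MeasurableSpace α] {ν : Measure α}
    {τ : α → ℝ} (hτ : ∀ᵐ x ∂ν, τ x ∈ Icc (0 : ℝ) 1)
    (hint : ∀ n, a ≤ n → Integrable (fun x => τ x ^ n) ν)
    (hA : ∀ w : ℂ, ‖w‖ = 1 → ‖∑ n ∈ Finset.Icc a b, c n * w ^ n‖ ≤ A) {w : ℂ} (hw : ‖w‖ = 1) :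
    ‖∑ n ∈ Finset.Icc a b, (c n * (∫ x, τ x ^ n ∂ν : ℝ)) * w ^ n‖ ≤ (∫ x, τ x ^ a ∂ν) * A := by
  have e : ∑ n ∈ Finset.Icc a b, (c n * (∫ x, τ x ^ n ∂ν : ℝ)) * w ^ n
      = ∫ x, ∑ n ∈ Finset.Icc a b, c n * (τ x * w) ^ n ∂ν := by
    have h1 : ∀ n ∈ Finset.Icc a b, Integrable (fun x => c n * ((τ x : ℂ) * w) ^ n) ν := by
      intro n hn
      have h2 := ((hint n (Finset.mem_Icc.1 hn).1).ofReal (𝕜 := ℂ)).const_mul (c n * w ^ n)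
      refine h2.congr (Eventually.of_forall fun x => ?_)
      push_cast
      rw [mul_pow]
      simp
      ring
    rw [integral_finsetSum _ h1]
    refine Finset.sum_congr rfl fun n _ => ?_
    rw [← integral_complex_ofReal, mul_right_comm, ← integral_const_mul]
    congr 1
    ext x
    push_cast
    ring
  rw [e, ← integral_mul_const]
  refine norm_integral_le_of_norm_le ((hint a le_rfl).mul_const A) ?_
  filter_upwards [hτ] with x hx
  exact norm_dilation_le_of_norm_le_on_circle hA hx.1 hx.2 hw

lemma norm_div_natCast_le_of_norm_le_on_circle (ha : 1 ≤ a)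
    (hA : ∀ w : ℂ, ‖w‖ = 1 → ‖∑ n ∈ Finset.Icc a b, c n * w ^ n‖ ≤ A) {w : ℂ} (hw : ‖w‖ = 1) :
    ‖∑ n ∈ Finset.Icc a b, (c n * (n : ℂ)⁻¹) * w ^ n‖ ≤ (a : ℝ)⁻¹ * A := by
  have hexp : ∀ n : ℕ, (fun x : ℝ => Real.exp (-x) ^ n) = fun x => Real.exp (-(n : ℝ) * x) := by
    intro n
    ext x
    rw [← Real.exp_nat_mul]
    congr 1
    ring
  have hval : ∀ n : ℕ, 1 ≤ n → ∫ x in Ioi (0 : ℝ), Real.exp (-x) ^ n = (n : ℝ)⁻¹ := by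
    intro n hn
    have hn0 : (0 : ℝ) < n := by exact_mod_cast hn
    rw [hexp, integral_exp_mul_Ioi (by linarith)]
    simp
  have h := norm_multiplier_le_of_norm_le_on_circle (ν := volume.restrict (Ioi (0 : ℝ)))
    (τ := fun x => Real.exp (-x)) ?_ ?_ hA hw
  · rw [hval a ha] at h
    refine le_trans (le_of_eq ?_) h
    congr 1
    refine Finset.sum_congr rfl fun n hn => ?_
    rw [hval n (ha.trans (Finset.mem_Icc.1 hn).1)]
    push_cast
    rfl
  · filter_upwards [ae_restrict_mem measurableSet_Ioi] with x hx
    exact ⟨(Real.exp_pos _).le, Real.exp_le_one_iff.2 (neg_nonpos.2 (le_of_lt hx))⟩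
  · intro n hn
    have hn0 : (0 : ℝ) < n := by exact_mod_cast (ha.trans hn)
    rw [hexp]
    exact integrableOn_exp_mul_Ioi (by linarith) 0

end CircleMultipliers

/-! ### Fejér means -/

section Fejer

/-- Orthogonality of the powers of `e^{iθ}` on the circle. -/
lemma integral_circleMap_pow_mul_conj_pow (m n : ℕ) :
    ∫ θ in Ioc 0 (2 * Real.pi), circleMap 0 1 θ ^ m * conj (circleMap 0 1 θ) ^ n
      = if m = n then (2 * Real.pi : ℂ) else 0 := by
  have hpi : (0 : ℝ) ≤ 2 * Real.pi := by positivity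
  have e : ∀ θ : ℝ, circleMap 0 1 θ ^ m * conj (circleMap 0 1 θ) ^ n
      = Complex.exp ((((m : ℂ) - n) * Complex.I) * θ) := by
    intro θ
    simp only [circleMap_zero, Complex.ofReal_one, one_mul]
    rw [← Complex.exp_conj, ← Complex.exp_nat_mul, ← Complex.exp_nat_mul, ← Complex.exp_add]
    congr 1
    simp
    ring
  simp only [e]
  rw [← intervalIntegral.integral_of_le hpi]
  split_ifs with h
  · simp [h]
  · have hmn : (m : ℂ) - n ≠ 0 := sub_ne_zero.2 (by exact_mod_cast h)
    rw [integral_exp_mul_complex (mul_ne_zero hmn Complex.I_ne_zero)]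
    have : Complex.exp (((m : ℂ) - n) * Complex.I * ((2 * Real.pi : ℝ) : ℂ)) = 1 := by
      have := Complex.exp_int_mul_two_pi_mul_I ((m : ℤ) - n)
      rw [← this]
      push_cast
      congr 1
      ring
    rw [this]
    simp

/-- The square modulus of the Dirichlet polynomial `∑_{k < M} e^{ikθ}`. -/
noncomputable def dirichletSq (M : ℕ) (θ : ℝ) : ℝ :=
  ‖∑ k ∈ Finset.range M, circleMap 0 1 θ ^ k‖ ^ 2

lemma continuous_dirichletSq (M : ℕ) : Continuous (dirichletSq M) := by
  unfold dirichletSq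
  have := continuous_circleMap 0 1
  fun_prop

lemma dirichletSq_eq (M : ℕ) (θ : ℝ) : (dirichletSq M θ : ℂ)
    = ∑ i ∈ Finset.range M, ∑ j ∈ Finset.range M,
      circleMap 0 1 θ ^ i * conj (circleMap 0 1 θ) ^ j := by
  have := Complex.mul_conj (∑ k ∈ Finset.range M, circleMap 0 1 θ ^ k)
  rw [dirichletSq, ← Complex.normSq_eq_norm_sq, ← this, map_sum, Finset.sum_mul_sum]
  simp only [map_pow]

lemma integral_circleMap_pow_mul_dirichletSq (M n : ℕ) :
    ∫ θ in Ioc 0 (2 * Real.pi), circleMap 0 1 θ ^ n * (dirichletSq M θ : ℂ)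
      = 2 * Real.pi * ((M - n : ℕ) : ℂ) := by
  have hc := continuous_circleMap (0 : ℂ) 1
  have hcc : Continuous fun θ => conj (circleMap (0 : ℂ) 1 θ) := Complex.continuous_conj.comp hc
  have e : ∀ θ, circleMap 0 1 θ ^ n * (dirichletSq M θ : ℂ)
      = ∑ i ∈ Finset.range M, ∑ j ∈ Finset.range M,
        circleMap 0 1 θ ^ (n + i) * conj (circleMap 0 1 θ) ^ j := by
    intro θ
    rw [dirichletSq_eq]
    simp only [Finset.mul_sum, pow_add, mul_assoc]
  have hi : ∀ i j, Integrable (fun θ => circleMap (0 : ℂ) 1 θ ^ (n + i) *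
      conj (circleMap 0 1 θ) ^ j) (volume.restrict (Ioc 0 (2 * Real.pi))) := fun i j =>
    Continuous.integrableOn_Ioc (by fun_prop)
  simp only [e]
  rw [integral_finsetSum _ fun i _ => integrable_finsetSum _ fun j _ => hi i j]
  have h1 : ∀ i ∈ Finset.range M, (∫ θ in Ioc 0 (2 * Real.pi), ∑ j ∈ Finset.range M,
      circleMap (0 : ℂ) 1 θ ^ (n + i) * conj (circleMap 0 1 θ) ^ j)
        = if n + i < M then (2 * Real.pi : ℂ) else 0 := by
    intro i _
    rw [integral_finsetSum _ fun j _ => hi i j]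
    simp only [integral_circleMap_pow_mul_conj_pow]
    rw [Finset.sum_ite_eq]
    simp
  rw [Finset.sum_congr rfl h1, ← Finset.sum_filter, Finset.sum_const]
  have h2 : (Finset.range M).filter (fun i => n + i < M) = Finset.range (M - n) := by
    ext i
    simp
    omega
  rw [h2, Finset.card_range, nsmul_eq_mul]
  ring

/-- Fejér means do not increase the supremum norm on the circle. -/
lemma norm_fejer_sum_le {q : ℕ → ℂ} (hq : Summable fun n => ‖q n‖) {Q : ℂ → ℂ}
    (hQ : ∀ w : ℂ, ‖w‖ = 1 → HasSum (fun n => q n * w ^ n) (Q w)) {A : ℝ}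
    (hA : ∀ w : ℂ, ‖w‖ = 1 → ‖Q w‖ ≤ A) (M : ℕ) {w : ℂ} (hw : ‖w‖ = 1) :
    ‖∑ n ∈ Finset.range M, ((M - n : ℕ) : ℂ) * (q n * w ^ n)‖ ≤ M * A := by
  have hc := continuous_circleMap (0 : ℂ) 1
  have hd := continuous_dirichletSq M
  set ν := volume.restrict (Ioc 0 (2 * Real.pi)) with hν
  have hu : ∀ θ, ‖circleMap (0 : ℂ) 1 θ‖ = 1 := norm_circleMap_zero_one
  have hwu : ∀ θ, ‖w * circleMap 0 1 θ‖ = 1 := fun θ => by rw [norm_mul, hw, hu, one_mul]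
  have h1 : ∀ n, Integrable (fun θ => q n * w ^ n * (circleMap 0 1 θ ^ n * (dirichletSq M θ : ℂ)))
      ν := fun n => Continuous.integrableOn_Ioc (by fun_prop)
  have hdi : Integrable (dirichletSq M) ν := hd.integrableOn_Ioc
  have hd0 : ∀ θ, 0 ≤ dirichletSq M θ := fun θ => by unfold dirichletSq; positivity
  have h2 : Summable fun n => ∫ θ, ‖q n * w ^ n * (circleMap 0 1 θ ^ n * (dirichletSq M θ : ℂ))‖
      ∂ν := by
    refine (hq.mul_right (∫ θ, dirichletSq M θ ∂ν)).congr fun n => ?_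
    rw [← integral_const_mul]
    refine integral_congr_ae (Eventually.of_forall fun θ => ?_)
    simp only [norm_mul, norm_pow, hw, hu, one_pow, mul_one, one_mul, Complex.norm_real,
      Real.norm_of_nonneg (hd0 θ)]
  have h3 := hasSum_integral_of_summable_integral_norm h1 h2
  simp only [integral_const_mul] at h3
  rw [hν] at h3
  simp only [integral_circleMap_pow_mul_dirichletSq] at h3
  have h4 : (fun θ => ∑' n, q n * w ^ n * (circleMap 0 1 θ ^ n * (dirichletSq M θ : ℂ)))
      = fun θ => Q (w * circleMap 0 1 θ) * (dirichletSq M θ : ℂ) := by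
    ext θ
    rw [← (hQ _ (hwu θ)).tsum_eq, ← tsum_mul_right]
    exact tsum_congr fun n => by ring
  rw [h4] at h3
  -- The truncated subtraction M - n vanishes for n ≥ M, so the series is a finite sum.
  have h5 : HasSum (fun n => q n * w ^ n * (2 * Real.pi * ((M - n : ℕ) : ℂ)))
      (∑ n ∈ Finset.range M, q n * w ^ n * (2 * Real.pi * ((M - n : ℕ) : ℂ))) :=
    hasSum_sum_of_ne_finset_zero fun n hn => by
      rw [Finset.mem_range, not_lt] at hn
      simp [Nat.sub_eq_zero_of_le hn]
  have h6 := h5.unique h3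
  have h7 : ‖∫ θ in Ioc 0 (2 * Real.pi), Q (w * circleMap 0 1 θ) * (dirichletSq M θ : ℂ)‖
      ≤ ∫ θ in Ioc 0 (2 * Real.pi), A * dirichletSq M θ := by
    refine norm_integral_le_of_norm_le (hdi.const_mul A) (Eventually.of_forall fun θ => ?_)
    rw [norm_mul, Complex.norm_real, Real.norm_of_nonneg (hd0 θ)]
    exact mul_le_mul_of_nonneg_right (hA _ (hwu θ)) (hd0 θ)
  have h8 : ∫ θ in Ioc 0 (2 * Real.pi), dirichletSq M θ = 2 * Real.pi * M := by
    have h := integral_circleMap_pow_mul_dirichletSq M 0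
    simp only [pow_zero, one_mul, Nat.sub_zero, integral_complex_ofReal] at h
    exact_mod_cast h
  rw [← h6, integral_const_mul, h8] at h7
  have h9 : ∑ n ∈ Finset.range M, q n * w ^ n * (2 * Real.pi * ((M - n : ℕ) : ℂ))
      = ((2 * Real.pi : ℝ) : ℂ) * ∑ n ∈ Finset.range M, ((M - n : ℕ) : ℂ) * (q n * w ^ n) := by
    rw [Finset.mul_sum]
    refine Finset.sum_congr rfl fun n _ => ?_
    push_cast
    ring
  rw [h9, norm_mul, Complex.norm_real, Real.norm_of_nonneg (by positivity)] at h7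
  have hpi : 0 < 2 * Real.pi := by positivity
  refine le_of_mul_le_mul_left (a := 2 * Real.pi) ?_ hpi
  linarith

end Fejer

end RadialBergman

/-! ### Blocks of frequencies and de la Vallée Poussin multipliers -/

namespace RadialBergman

section Blocks

/-- A slowly growing sequence of cut-off frequencies. -/
def cutoff : ℕ → ℕ
  | 0 => 0
  | j + 1 => cutoff j + 1 + cutoff j / 8

/-- The piecewise linear function of `n` that is `1` for `n ≤ M` and `0` for `n ≥ M'`. -/
noncomputable def ramp (M M' n : ℕ) : ℝ := (((M' - n : ℕ) : ℝ) - ((M - n : ℕ) : ℝ)) / ((M' : ℝ) - M)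

/-- The first frequency of the `j`-th block. -/
def blockLow (j : ℕ) : ℕ := cutoff j + 1

/-- The last frequency of the `j`-th block. -/
def blockHigh (j : ℕ) : ℕ := cutoff (j + 2) - 1

/-- The multiplier of the `j`-th block; it lives on `[blockLow j, blockHigh j]`. -/
noncomputable def blockCoeff (j n : ℕ) : ℝ :=
  ramp (cutoff (j + 1)) (cutoff (j + 2)) n - ramp (cutoff j) (cutoff (j + 1)) n

lemma cutoff_succ (j : ℕ) : cutoff (j + 1) = cutoff j + 1 + cutoff j / 8 := rfl

lemma cutoff_lt_succ (j : ℕ) : cutoff j < cutoff (j + 1) := by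
  rw [cutoff_succ]; omega

lemma le_cutoff (j : ℕ) : j ≤ cutoff j := by
  induction j with
  | zero => exact Nat.zero_le _
  | succ j ih => have := cutoff_lt_succ j; omega

lemma one_le_blockLow (j : ℕ) : 1 ≤ blockLow j := Nat.le_add_left 1 _

/-- A block spans two steps of ratio about 9/8, and (9/8)² < 3/2. The bound 3/2 keeps r^(2a) r^(-b)
≤ r^(a/2) in `profile_le`. -/
lemma two_mul_blockHigh_le (j : ℕ) : 2 * blockHigh j ≤ 3 * blockLow j := by
  unfold blockHigh blockLow
  have h1 := cutoff_succ j
  have h2 := cutoff_succ (j + 1)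
  rw [show j + 1 + 1 = j + 2 from rfl] at h2
  omega

lemma blockLow_succ_le (j : ℕ) :
    blockLow (j + 1) ≤ 9 * (blockLow (j + 1) - blockLow j) ∧ blockLow j ≤ blockLow (j + 1) := by
  unfold blockLow
  have h1 := cutoff_succ j
  omega

lemma ramp_of_le {M M' n : ℕ} (hM : M < M') (h : n ≤ M) : ramp M M' n = 1 := by
  have h1 : (M : ℝ) < M' := by exact_mod_cast hM
  rw [ramp, Nat.cast_sub h, Nat.cast_sub (h.trans hM.le), sub_sub_sub_cancel_right, div_self]
  linarith

lemma ramp_of_ge {M M' n : ℕ} (hM : M < M') (h : M' ≤ n) : ramp M M' n = 0 := by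
  rw [ramp, Nat.sub_eq_zero_of_le h, Nat.sub_eq_zero_of_le (hM.le.trans h)]
  simp

lemma blockCoeff_zero (j : ℕ) : blockCoeff j 0 = 0 := by
  rw [blockCoeff, ramp_of_le (cutoff_lt_succ _) (Nat.zero_le _),
    ramp_of_le (cutoff_lt_succ _) (Nat.zero_le _), sub_self]

lemma blockCoeff_of_notMem {j n : ℕ} (h : n ∉ Finset.Icc (blockLow j) (blockHigh j)) :
    blockCoeff j n = 0 := by
  have h1 := cutoff_lt_succ j
  have h2 := cutoff_lt_succ (j + 1)
  rw [show j + 1 + 1 = j + 2 from rfl] at h2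
  rw [Finset.mem_Icc, blockLow, blockHigh, not_and_or, not_le, not_le] at h
  rw [blockCoeff]
  rcases h with h | h
  · rw [ramp_of_le h2 (by omega), ramp_of_le h1 (by omega), sub_self]
  · rw [ramp_of_ge h2 (by omega), ramp_of_ge h1 (by omega), sub_self]

lemma sum_blockCoeff {n J : ℕ} (hn : 1 ≤ n) (hJ : n ≤ J) :
    ∑ j ∈ Finset.range J, blockCoeff j n = 1 := by
  simp only [blockCoeff]
  rw [Finset.sum_range_sub (fun j => ramp (cutoff j) (cutoff (j + 1)) n),
    ramp_of_le (cutoff_lt_succ _) (hJ.trans (le_cutoff _)), ramp_of_ge (cutoff_lt_succ _) ?_,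
    sub_zero]
  simpa [cutoff] using hn

variable {q : ℕ → ℂ} {Q : ℂ → ℂ} {A : ℝ}

/-- The ramp is a difference of two unnormalized Fejér weights, with norms M' and M, divided by M' -
M. -/
lemma norm_ramp_sum_le (hq : Summable fun n => ‖q n‖)
    (hQ : ∀ w : ℂ, ‖w‖ = 1 → HasSum (fun n => q n * w ^ n) (Q w))
    (hA : ∀ w : ℂ, ‖w‖ = 1 → ‖Q w‖ ≤ A) {M M' R : ℕ} (hM : M < M') (hR : M' ≤ R) {w : ℂ}
    (hw : ‖w‖ = 1) :
    ‖∑ n ∈ Finset.range R, (ramp M M' n : ℂ) * (q n * w ^ n)‖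
      ≤ ((M' : ℝ) + M) / ((M' : ℝ) - M) * A := by
  have hd : (0 : ℝ) < (M' : ℝ) - M := sub_pos.2 (by exact_mod_cast hM)
  have extend : ∀ {N : ℕ}, N ≤ R → ‖∑ n ∈ Finset.range R, ((N - n : ℕ) : ℂ) * (q n * w ^ n)‖
      ≤ N * A := by
    intro N hN
    refine le_trans (le_of_eq ?_) (norm_fejer_sum_le hq hQ hA N hw)
    congr 1
    refine (Finset.sum_subset (Finset.range_mono hN) fun n _ hn => ?_).symm
    rw [Finset.mem_range, not_lt] at hn
    simp [Nat.sub_eq_zero_of_le hn]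
  have e : ∑ n ∈ Finset.range R, (ramp M M' n : ℂ) * (q n * w ^ n)
      = (((M' : ℝ) - M : ℝ) : ℂ)⁻¹ * (∑ n ∈ Finset.range R, ((M' - n : ℕ) : ℂ) * (q n * w ^ n)
        - ∑ n ∈ Finset.range R, ((M - n : ℕ) : ℂ) * (q n * w ^ n)) := by
    rw [← Finset.sum_sub_distrib, Finset.mul_sum]
    refine Finset.sum_congr rfl fun n _ => ?_
    rw [ramp]
    push_cast
    ring
  rw [e, norm_mul, norm_inv, Complex.norm_real, Real.norm_of_nonneg hd.le, div_mul_eq_mul_div,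
    ← div_eq_inv_mul]
  refine div_le_div_of_nonneg_right ((norm_sub_le _ _).trans ?_) hd.le
  rw [add_mul]
  exact add_le_add (extend hR) (extend (hM.le.trans hR))

lemma cutoff_ratio_le (j : ℕ) :
    ((cutoff (j + 1) : ℝ) + cutoff j) / ((cutoff (j + 1) : ℝ) - cutoff j) ≤ 17 := by
  have h : (cutoff j : ℝ) < cutoff (j + 1) := by exact_mod_cast cutoff_lt_succ j
  rw [div_le_iff₀ (sub_pos.2 h)]
  have h2 : 18 * cutoff j ≤ 16 * cutoff (j + 1) := by
    have := cutoff_succ j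
    omega
  have h3 : (18 : ℝ) * cutoff j ≤ 16 * cutoff (j + 1) := by exact_mod_cast h2
  linarith

lemma norm_blockCoeff_sum_le (hq : Summable fun n => ‖q n‖)
    (hQ : ∀ w : ℂ, ‖w‖ = 1 → HasSum (fun n => q n * w ^ n) (Q w))
    (hA : ∀ w : ℂ, ‖w‖ = 1 → ‖Q w‖ ≤ A) (j : ℕ) {w : ℂ} (hw : ‖w‖ = 1) :
    ‖∑ n ∈ Finset.Icc (blockLow j) (blockHigh j), (blockCoeff j n * q n) * w ^ n‖ ≤ 34 * A := by
  have hA0 : 0 ≤ A := (norm_nonneg _).trans (hA 1 norm_one)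
  have h2 : cutoff (j + 1) < cutoff (j + 2) := cutoff_lt_succ (j + 1)
  have hsub : Finset.Icc (blockLow j) (blockHigh j) ⊆ Finset.range (cutoff (j + 2)) := by
    intro n hn
    rw [Finset.mem_Icc, blockHigh] at hn
    rw [Finset.mem_range]
    omega
  rw [Finset.sum_subset hsub fun n _ hn => by rw [blockCoeff_of_notMem hn]; simp]
  have e : ∑ n ∈ Finset.range (cutoff (j + 2)), (blockCoeff j n * q n) * w ^ n
      = ∑ n ∈ Finset.range (cutoff (j + 2)),
          (ramp (cutoff (j + 1)) (cutoff (j + 2)) n : ℂ) * (q n * w ^ n)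
        - ∑ n ∈ Finset.range (cutoff (j + 2)),
          (ramp (cutoff j) (cutoff (j + 1)) n : ℂ) * (q n * w ^ n) := by
    rw [← Finset.sum_sub_distrib]
    refine Finset.sum_congr rfl fun n _ => ?_
    rw [blockCoeff]
    push_cast
    ring
  rw [e]
  have b1 := norm_ramp_sum_le hq hQ hA h2 le_rfl hw
  have b2 := norm_ramp_sum_le hq hQ hA (cutoff_lt_succ j) h2.le hw
  have r1 := mul_le_mul_of_nonneg_right (cutoff_ratio_le (j + 1)) hA0
  have r2 := mul_le_mul_of_nonneg_right (cutoff_ratio_le j) hA0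
  refine (norm_sub_le _ _).trans ?_
  linarith

/-- The series `∑ a_j (1 - s) s^{a_j}` over the block frequencies is bounded in `s`. -/
lemma sum_blockLow_mul_pow_le {s : ℝ} (hs0 : 0 ≤ s) (hs1 : s ≤ 1) (J : ℕ) :
    ∑ j ∈ Finset.range J, (blockLow j : ℝ) * (1 - s) * s ^ blockLow j ≤ 10 := by
  have step : ∀ p d : ℕ, (d : ℝ) * (1 - s) * s ^ (p + d) ≤ s ^ p - s ^ (p + d) := by
    intro p d
    have h1 : (d : ℝ) * s ^ d ≤ ∑ k ∈ Finset.range d, s ^ k := by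
      have := Finset.card_nsmul_le_sum (Finset.range d) (fun k => s ^ k) (s ^ d)
        fun k hk => pow_le_pow_of_le_one hs0 hs1 (Finset.mem_range.1 hk).le
      simpa using this
    have h2 := geom_sum_mul_neg s d
    have h3 : (d : ℝ) * s ^ d * (1 - s) ≤ 1 - s ^ d := by
      rw [← h2]
      exact mul_le_mul_of_nonneg_right h1 (by linarith)
    have h4 : 0 ≤ s ^ p := by positivity
    rw [pow_add]
    nlinarith
  -- Since each a is at most 9 times the preceding gap, each new term is at most 9 times a
  -- telescoping difference of powers s^a; the subtracted 9 s^a carries the telescoping.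
  have main : ∀ J : ℕ, ∑ j ∈ Finset.range (J + 1), (blockLow j : ℝ) * (1 - s) * s ^ blockLow j
      ≤ 10 - 9 * s ^ blockLow J := by
    intro J
    induction J with
    | zero =>
      simp [blockLow, cutoff]
      nlinarith
    | succ J ih =>
      obtain ⟨h1, h2⟩ := blockLow_succ_le J
      rw [Finset.sum_range_succ]
      obtain ⟨d, hd⟩ := Nat.exists_eq_add_of_le h2
      rw [hd, Nat.add_sub_cancel_left] at h1
      rw [hd]
      have h3 : ((blockLow J + d : ℕ) : ℝ) ≤ 9 * d := by exact_mod_cast h1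
      have h4 := step (blockLow J) d
      have h5 : 0 ≤ (1 - s) * s ^ (blockLow J + d) :=
        mul_nonneg (by linarith) (by positivity)
      nlinarith
  refine le_trans ?_ ((main J).trans (by have : 0 ≤ s ^ blockLow J := by positivity
                                         linarith))
  refine Finset.sum_le_sum_of_subset_of_nonneg (Finset.range_mono (Nat.le_succ J)) fun j _ _ => ?_
  have : 0 ≤ 1 - s := by linarith
  positivity

end Blocks

/-! ### Circle bounds for the blocks of a Bloch function -/

section Bloch

lemma taylorCoeff_deriv (f : ℂ → ℂ) (n : ℕ) :
    taylorCoeff (deriv f) n = (n + 1) * taylorCoeff f (n + 1) := by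
  rw [taylorCoeff, taylorCoeff, ← iteratedDeriv_succ', Nat.factorial_succ]
  have h1 : (n.factorial : ℂ) ≠ 0 := by exact_mod_cast n.factorial_ne_zero
  have h2 : ((n : ℂ) + 1) ≠ 0 := by exact_mod_cast n.succ_ne_zero
  push_cast
  field_simp

lemma IsAnalyticInDisc.hasSum_mul_deriv {f : ℂ → ℂ} (hf : IsAnalyticInDisc f) {z : ℂ}
    (hz : ‖z‖ < 1) : HasSum (fun n : ℕ => n * taylorCoeff f n * z ^ n) (z * deriv f z) := by
  have hd : IsAnalyticInDisc (deriv f) := hf.deriv isOpen_unitDisc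
  have h := (hd.hasSum_taylorCoeff hz).mul_left z
  rw [← hasSum_nat_add_iff' 1]
  simp only [Finset.range_one, Finset.sum_singleton, Nat.cast_zero, zero_mul, sub_zero]
  refine h.congr_fun ?_ |> fun h => h
  intro n
  rw [taylorCoeff_deriv]
  push_cast
  ring

lemma MemBloch.norm_deriv_le {f : ℂ → ℂ} (hf : MemBloch f) {z : ℂ} (hz : ‖z‖ < 1) :
    ‖deriv f z‖ * (1 - ‖z‖ ^ 2) ≤ blochNorm f := by
  have h : blochDensity f z ≤ sSup (blochDensity f '' unitDisc) :=
    le_csSup hf.2 ⟨z, mem_unitDisc.2 hz, rfl⟩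
  have := norm_nonneg (f 0)
  rw [blochNorm]
  exact h.trans (by linarith)

lemma one_add_inv_pow_le {a b : ℕ} (ha : 1 ≤ a) (hab : 2 * b ≤ 3 * a) :
    (((a : ℝ) / (a + 1))⁻¹) ^ b ≤ 9 := by
  have ha0 : (0 : ℝ) < a := by exact_mod_cast ha
  have h1 : ((a : ℝ) / (a + 1))⁻¹ = 1 + 1 / a := by field_simp
  have h2 : 1 + 1 / (a : ℝ) ≤ Real.exp (1 / a) := by linarith [Real.add_one_le_exp (1 / (a : ℝ))]
  have hab' : (2 : ℝ) * b ≤ 3 * a := by exact_mod_cast hab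
  calc (((a : ℝ) / (a + 1))⁻¹) ^ b ≤ Real.exp (1 / a) ^ b := by rw [h1]; gcongr
    _ = Real.exp (b * (1 / a)) := (Real.exp_nat_mul _ _).symm
    _ ≤ Real.exp (2 : ℕ) := by
      refine Real.exp_le_exp.2 ?_
      rw [mul_one_div, div_le_iff₀ ha0]
      push_cast
      linarith
    _ = Real.exp 1 ^ 2 := by rw [← Real.exp_nat_mul]; simp
    _ ≤ 3 ^ 2 := by
      have := Real.exp_one_lt_d9
      gcongr
      linarith
    _ = 9 := by norm_num

/-- The block projections of a Bloch function are uniformly bounded on the unit circle. -/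
lemma MemBloch.norm_block_le {f : ℂ → ℂ} (hf : MemBloch f) (j : ℕ) {w : ℂ} (hw : ‖w‖ = 1) :
    ‖∑ n ∈ Finset.Icc (blockLow j) (blockHigh j), (blockCoeff j n * taylorCoeff f n) * w ^ n‖
      ≤ 612 * blochNorm f := by
  set a := blockLow j with ha
  set b := blockHigh j with hb
  set B := blochNorm f with hB
  have ha1 : 1 ≤ a := one_le_blockLow j
  have ha0 : (0 : ℝ) < a := by exact_mod_cast ha1
  have ha1' : (1 : ℝ) ≤ a := by exact_mod_cast ha1
  -- At this radius 1/(1-ρ) = a + 1, so z f' is at most 2aB there, while undoing the dilation on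
  -- frequencies up to b ≤ 3a/2 costs at most a constant.
  set ρ : ℝ := (a : ℝ) / (a + 1) with hρ
  have hρ0 : 0 < ρ := by positivity
  have hρ1 : ρ < 1 := by rw [hρ, div_lt_one (by positivity)]; linarith
  have hρne : (ρ : ℂ) ≠ 0 := by exact_mod_cast hρ0.ne'
  have hρa : 1 - ρ = (a + 1 : ℝ)⁻¹ := by rw [hρ]; field_simp; ring
  set q : ℕ → ℂ := fun n => n * taylorCoeff f n * (ρ : ℂ) ^ n with hq
  have hnorm : ∀ w : ℂ, ‖w‖ = 1 → ‖(ρ : ℂ) * w‖ = ρ := fun w hw => by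
    rw [norm_mul, hw, mul_one, Complex.norm_real, Real.norm_of_nonneg hρ0.le]
  have hQ : ∀ w : ℂ, ‖w‖ = 1 → HasSum (fun n => q n * w ^ n) (ρ * w * deriv f (ρ * w)) := by
    intro w hw
    have h := hf.1.hasSum_mul_deriv (z := ρ * w) (by rw [hnorm w hw]; exact hρ1)
    simpa only [hq, mul_pow, mul_assoc] using h
  have hqs : Summable fun n => ‖q n‖ := by
    have := (hQ 1 norm_one).summable.norm
    simpa using this
  have hA : ∀ w : ℂ, ‖w‖ = 1 → ‖ρ * w * deriv f (ρ * w)‖ ≤ 2 * a * B := by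
    intro w hw
    have h := hf.norm_deriv_le (z := ρ * w) (by rw [hnorm w hw]; exact hρ1)
    rw [hnorm w hw] at h
    rw [norm_mul, hnorm w hw]
    have hD := norm_nonneg (deriv f (ρ * w))
    have h1 : ‖deriv f (ρ * w)‖ * (1 - ρ) ≤ B := by
      refine le_trans ?_ h
      gcongr
      nlinarith
    rw [hρa, ← div_eq_mul_inv, div_le_iff₀ (by positivity)] at h1
    have hB0 : 0 ≤ B := le_trans (by have : 0 ≤ 1 - ρ ^ 2 := by nlinarith
                                     positivity) h
    calc ρ * ‖deriv f (ρ * w)‖ ≤ 1 * ‖deriv f (ρ * w)‖ := by gcongr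
      _ ≤ B * (a + 1) := by linarith
      _ ≤ 2 * a * B := by nlinarith
  have s1 : ∀ w : ℂ, ‖w‖ = 1 →
      ‖∑ n ∈ Finset.Icc a b, (blockCoeff j n * q n) * w ^ n‖ ≤ 34 * (2 * a * B) := fun w hw =>
    norm_blockCoeff_sum_le hqs hQ hA j hw
  have hB0 : 0 ≤ 34 * (2 * a * B) := (norm_nonneg _).trans (s1 1 norm_one)
  have s2 : ∀ w : ℂ, ‖w‖ = 1 →
      ‖∑ n ∈ Finset.Icc a b, (blockCoeff j n * taylorCoeff f n * n) * w ^ n‖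
        ≤ 9 * (34 * (2 * a * B)) := by
    intro w hw
    have h := norm_inv_dilation_le_of_norm_le_on_circle s1 hρ0 hρ1.le hw
    have h9 := one_add_inv_pow_le ha1 (two_mul_blockHigh_le j)
    refine le_trans (le_of_eq ?_) (h.trans (mul_le_mul_of_nonneg_right h9 hB0))
    congr 1
    refine Finset.sum_congr rfl fun n _ => ?_
    rw [hq, mul_pow, inv_pow]
    field_simp
  -- Dividing by n turns coefficients of z f' into those of f and gains 1/a, cancelling the growth;
  -- 612 = 9 · 34 · 2.
  have s3 := norm_div_natCast_le_of_norm_le_on_circle ha1 s2 hw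
  have e : (a : ℝ)⁻¹ * (9 * (34 * (2 * a * B))) = 612 * B := by field_simp; ring
  rw [e] at s3
  refine le_trans (le_of_eq ?_) s3
  congr 1
  refine Finset.sum_congr rfl fun n hn => ?_
  have hn0 : (n : ℂ) ≠ 0 := by
    have := ha1.trans (Finset.mem_Icc.1 hn).1
    exact_mod_cast (by omega : n ≠ 0)
  field_simp

end Bloch

end RadialBergman

/-! ### Bounded symbols for the blocks: from the class 𝓜 to preimages in L^∞ -/

namespace RadialBergman

variable {ω : ℝ → ℝ}

lemma ClassM.exists_nat (hω : IsRadialWeight ω) (hM : ClassM ω) :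
    ∃ (C : ℝ) (K : ℕ), 1 < C ∧ 1 ≤ K ∧ ∀ a : ℕ, 1 ≤ a →
      C * normMoment ω (2 * (K * a)) ≤ normMoment ω (2 * a) := by
  obtain ⟨C, K, hC, hK, h⟩ := hM
  -- Doubling K absorbs the exponent shift: 4Ka ≥ K(2a + 1) for a ≥ 1.
  have hK2 : 2 * K ≤ (⌈2 * K⌉₊ : ℝ) := Nat.le_ceil _
  refine ⟨C, ⌈2 * K⌉₊, hC, Nat.one_le_ceil_iff.2 (by linarith), fun a ha => ?_⟩
  have ha' : (1 : ℝ) ≤ a := by exact_mod_cast ha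
  rw [hω.normMoment_eq, hω.normMoment_eq]
  have h1 := h ((2 * a : ℕ) + 1) (by push_cast; linarith)
  have h2 : moment ω (((2 * (⌈2 * K⌉₊ * a) : ℕ) : ℝ) + 1) ≤ moment ω (K * ((2 * a : ℕ) + 1)) := by
    refine hω.moment_antitone (by positivity) ?_
    push_cast
    nlinarith
  have h3 : C * moment ω (((2 * (⌈2 * K⌉₊ * a) : ℕ) : ℝ) + 1)
      ≤ C * moment ω (K * ((2 * a : ℕ) + 1)) := by gcongr
  linarith

section Symbol

/-- The radial profile `(r^{2a} - r^{2Ka}) / r^{2n}`. -/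
noncomputable def radialProfile (K a n : ℕ) (r : ℝ) : ℝ :=
  (r ^ (2 * a) - r ^ (2 * (K * a))) / r ^ (2 * n)

lemma measurable_radialProfile_mul_pow (K a n : ℕ) :
    Measurable fun z : ℂ => (radialProfile K a n ‖z‖ : ℂ) * z ^ n := by
  unfold radialProfile
  fun_prop

lemma norm_radialProfile_mul_pow_le {K a n : ℕ} (hK : 1 ≤ K) (hn : 1 ≤ n) (hna : n ≤ 2 * a)
    {z : ℂ} (hz : ‖z‖ < 1) : ‖(radialProfile K a n ‖z‖ : ℂ) * z ^ n‖ ≤ 1 := by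
  rcases eq_or_ne z 0 with rfl | hz0
  · simp [zero_pow (by omega : n ≠ 0)]
  have hr : 0 < ‖z‖ := norm_pos_iff.2 hz0
  set r := ‖z‖ with hr'
  have h1 : r ^ (2 * (K * a)) ≤ r ^ (2 * a) :=
    pow_le_pow_of_le_one hr.le hz.le (by nlinarith)
  have h2 : 0 ≤ r ^ (2 * (K * a)) := by positivity
  have h3 : r ^ (2 * a) ≤ r ^ n := pow_le_pow_of_le_one hr.le hz.le hna
  have h4 : 0 ≤ radialProfile K a n r := div_nonneg (by linarith) (by positivity)
  rw [norm_mul, norm_pow, Complex.norm_real, Real.norm_of_nonneg h4, ← hr', radialProfile,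
    div_mul_eq_mul_div, div_le_one (by positivity), two_mul n, pow_add]
  exact mul_le_mul_of_nonneg_right (by linarith) (by positivity)

lemma IsRadialWeight.integrable_radialProfile_mul_pow (hω : IsRadialWeight ω) {K a n : ℕ}
    (hK : 1 ≤ K) (hn : 1 ≤ n) (hna : n ≤ 2 * a) :
    Integrable (fun z : ℂ => (radialProfile K a n ‖z‖ : ℂ) * z ^ n) (weightedMeasure ω) := by
  have := hω.isFiniteMeasure
  refine (MemLp.of_bound (p := 1) (measurable_radialProfile_mul_pow K a n).aestronglyMeasurable 1
    ?_).integrable le_rfl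
  filter_upwards [ae_norm_lt_one] with z hz using norm_radialProfile_mul_pow_le hK hn hna hz

lemma IsRadialWeight.integrable_norm_pow (hω : IsRadialWeight ω) (n : ℕ) :
    Integrable (fun z : ℂ => ‖z‖ ^ n) (weightedMeasure ω) := by
  have := hω.isFiniteMeasure
  simpa using (integrable_pow_mul (integrable_const (1 : ℂ)) n).norm

/-- Dividing by r^(2n) cancels |z^n|², so the diagonal integral does not depend on n and one
normalization serves a whole block. -/
lemma integral_radialProfile_mul_pow_mul_conj_pow (hω : IsRadialWeight ω) {K a n : ℕ} (hK : 1 ≤ K)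
    (ha : 1 ≤ a) (hn : 1 ≤ n) (m : ℕ) :
    ∫ z, (radialProfile K a n ‖z‖ : ℂ) * z ^ n * conj z ^ m ∂weightedMeasure ω
      = if n = m then ((normMoment ω (2 * a) - normMoment ω (2 * (K * a)) : ℝ) : ℂ) else 0 := by
  split_ifs with h
  · subst h
    have e : ∀ z : ℂ, (radialProfile K a n ‖z‖ : ℂ) * z ^ n * conj z ^ n
        = ((‖z‖ ^ (2 * a) - ‖z‖ ^ (2 * (K * a)) : ℝ) : ℂ) := by
      intro z
      rw [mul_assoc, ← mul_pow, Complex.mul_conj, Complex.normSq_eq_norm_sq, radialProfile]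
      norm_cast
      rw [← pow_mul]
      rcases eq_or_ne z 0 with rfl | hz
      · have : 2 * (K * a) ≠ 0 := by positivity
        simp only [norm_zero, zero_pow this, zero_pow (by omega : 2 * a ≠ 0),
          zero_pow (by omega : 2 * n ≠ 0), sub_zero, mul_zero]
      · have : ‖z‖ ≠ 0 := norm_ne_zero_iff.2 hz
        field_simp
    simp only [e]
    rw [integral_complex_ofReal,
      integral_sub (hω.integrable_norm_pow _) (hω.integrable_norm_pow _)]
    rfl
  · simp only [mul_assoc]
    exact integral_radial_mul_pow_mul_conj_pow_of_ne (fun r => (radialProfile K a n r : ℂ)) h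

/-- The bounded symbol whose Bergman projection is the `j`-th block of `f`. -/
noncomputable def blockSymbol (ω : ℝ → ℝ) (K : ℕ) (f : ℂ → ℂ) (j : ℕ) (z : ℂ) : ℂ :=
  ((normMoment ω (2 * blockLow j) - normMoment ω (2 * (K * blockLow j)) : ℝ) : ℂ)⁻¹ *
    ∑ n ∈ Finset.Icc (blockLow j) (blockHigh j),
      (blockCoeff j n * taylorCoeff f n * (normMoment ω (2 * n) : ℂ)) *
        ((radialProfile K (blockLow j) n ‖z‖ : ℂ) * z ^ n)

lemma measurable_blockSymbol (K : ℕ) (f : ℂ → ℂ) (j : ℕ) : Measurable (blockSymbol ω K f j) :=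
  Measurable.const_mul (Finset.measurable_fun_sum _ fun n _ =>
    (measurable_radialProfile_mul_pow K _ n).const_mul _) _

lemma blockSymbol_zero (K : ℕ) (f : ℂ → ℂ) (j : ℕ) : blockSymbol ω K f j 0 = 0 := by
  rw [blockSymbol, Finset.sum_eq_zero fun n hn => ?_, mul_zero]
  have := (one_le_blockLow j).trans (Finset.mem_Icc.1 hn).1
  rw [zero_pow (by omega), mul_zero, mul_zero]

lemma le_two_mul_blockLow {j n : ℕ} (hn : n ∈ Finset.Icc (blockLow j) (blockHigh j)) :
    n ≤ 2 * blockLow j := by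
  have h1 := two_mul_blockHigh_le j
  have h2 := (Finset.mem_Icc.1 hn).2
  omega

lemma integral_blockSymbol_mul_conj_pow (hω : IsRadialWeight ω) {K : ℕ} (hK : 1 ≤ K) {j : ℕ}
    (hD : normMoment ω (2 * blockLow j) - normMoment ω (2 * (K * blockLow j)) ≠ 0)
    (f : ℂ → ℂ) (m : ℕ) :
    ∫ z, blockSymbol ω K f j z * conj z ^ m ∂weightedMeasure ω
      = blockCoeff j m * taylorCoeff f m * normMoment ω (2 * m) := by
  have hlow : ∀ n ∈ Finset.Icc (blockLow j) (blockHigh j), 1 ≤ n := fun n hn =>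
    (one_le_blockLow j).trans (Finset.mem_Icc.1 hn).1
  simp only [blockSymbol, mul_assoc, Finset.sum_mul]
  rw [integral_const_mul, integral_finsetSum]
  · have h1 : ∀ n ∈ Finset.Icc (blockLow j) (blockHigh j),
        (∫ z, (blockCoeff j n : ℂ) * (taylorCoeff f n * ((normMoment ω (2 * n) : ℂ) *
          ((radialProfile K (blockLow j) n ‖z‖ : ℂ) * (z ^ n * conj z ^ m)))) ∂weightedMeasure ω)
        = if n = m then (blockCoeff j n * taylorCoeff f n * normMoment ω (2 * n)) *
          ((normMoment ω (2 * blockLow j) - normMoment ω (2 * (K * blockLow j)) : ℝ) : ℂ)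
          else 0 := by
      intro n hn
      have h2 := integral_radialProfile_mul_pow_mul_conj_pow hω hK (one_le_blockLow j) (hlow n hn) m
      simp only [mul_assoc] at h2
      simp only [integral_const_mul, h2, mul_ite, mul_zero, mul_assoc]
    rw [Finset.sum_congr rfl h1, Finset.sum_ite_eq']
    have hD' : ((normMoment ω (2 * blockLow j) - normMoment ω (2 * (K * blockLow j)) : ℝ) : ℂ) ≠ 0 :=
      by exact_mod_cast hD
    split_ifs with h
    · field_simp
    · rw [blockCoeff_of_notMem h]
      simp
  · intro n hn
    have h3 := hω.integrable_radialProfile_mul_pow hK (hlow n hn) (le_two_mul_blockLow hn)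
    have h4 := h3.mul_bdd (c := 1) (hω.integrable_conj_pow m).aestronglyMeasurable (by
      filter_upwards [ae_norm_lt_one] with z hz
      simpa using pow_le_one₀ (norm_nonneg _) hz.le)
    simp only [mul_assoc] at h4
    exact ((h4.const_mul _).const_mul _).const_mul _

lemma profile_le {K a b : ℕ} (hab : 2 * b ≤ 3 * a) {r : ℝ} (hr0 : 0 < r) (hr1 : r < 1) :
    (r ^ (2 * a) - r ^ (2 * (K * a))) * (r⁻¹) ^ b
      ≤ 4 * K * (a * (1 - √r) * √r ^ a) := by
  set s := √r with hs
  have hs0 : 0 < s := Real.sqrt_pos.2 hr0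
  have hs1 : s < 1 := by rw [hs, Real.sqrt_lt' one_pos]; simpa using hr1
  have hrs : r = s ^ 2 := (Real.sq_sqrt hr0.le).symm
  have h1 : 1 - r ^ (2 * (K * a)) ≤ 2 * (K * a) * (1 - r) := by
    have := one_add_mul_le_pow (a := r - 1) (by linarith) (2 * (K * a))
    rw [add_sub_cancel] at this
    push_cast at this
    linarith
  have h2 : r ^ (2 * a) - r ^ (2 * (K * a)) ≤ r ^ (2 * a) * (1 - r ^ (2 * (K * a))) := by
    have h3 : r ^ (2 * a) ≤ 1 := pow_le_one₀ hr0.le hr1.le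
    have h4 : 0 ≤ r ^ (2 * (K * a)) := by positivity
    nlinarith
  have h5 : 1 - r ≤ 2 * (1 - s) := by rw [hrs]; nlinarith
  have h6 : r ^ (2 * a) * (r⁻¹) ^ b ≤ s ^ a := by
    have : r ^ (2 * a) = r ^ (2 * a - b) * r ^ b := by
      rw [← pow_add, Nat.sub_add_cancel (by omega)]
    rw [this, mul_assoc, ← mul_pow, mul_inv_cancel₀ hr0.ne', one_pow, mul_one, hrs, ← pow_mul]
    exact pow_le_pow_of_le_one hs0.le hs1.le (by omega)
  have h7 : 0 ≤ r ^ (2 * a) * (r⁻¹) ^ b := by positivity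
  have h8 : (0 : ℝ) ≤ K * a := by positivity
  calc (r ^ (2 * a) - r ^ (2 * (K * a))) * (r⁻¹) ^ b
      ≤ r ^ (2 * a) * (1 - r ^ (2 * (K * a))) * (r⁻¹) ^ b := by gcongr
    _ = (1 - r ^ (2 * (K * a))) * (r ^ (2 * a) * (r⁻¹) ^ b) := by ring
    _ ≤ (2 * (K * a) * (2 * (1 - s))) * (r ^ (2 * a) * (r⁻¹) ^ b) := by
      gcongr
      exact h1.trans (by gcongr)
    _ ≤ (2 * (K * a) * (2 * (1 - s))) * s ^ a := by
      have : 0 ≤ 1 - s := by linarith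
      gcongr
    _ = _ := by ring

/-- On |z| = r the symbol is a radial factor times the block, multiplied by the moments m_n and
dilated outward to radius 1/r. The multiplication costs m_a, the dilation r^(-b), and the class 𝓜
cancels m_a against the normalization. -/
lemma norm_blockSymbol_le (hω : IsRadialWeight ω) {C : ℝ} {K : ℕ} (hC : 1 < C) (hK : 1 ≤ K)
    (hCK : ∀ a : ℕ, 1 ≤ a → C * normMoment ω (2 * (K * a)) ≤ normMoment ω (2 * a))
    {f : ℂ → ℂ} (hf : MemBloch f) (j : ℕ) {z : ℂ} (hz0 : z ≠ 0) (hz : ‖z‖ < 1) :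
    ‖blockSymbol ω K f j z‖ ≤ C / (C - 1) * (612 * blochNorm f) * (4 * K) *
      (blockLow j * (1 - √‖z‖) * √‖z‖ ^ blockLow j) := by
  set a := blockLow j with ha
  set b := blockHigh j with hb
  set r := ‖z‖ with hr
  have ha1 : 1 ≤ a := one_le_blockLow j
  have hr0 : 0 < r := norm_pos_iff.2 hz0
  set w : ℂ := (r : ℂ)⁻¹ * z with hw
  have hw1 : ‖w‖ = 1 := by
    rw [hw, norm_mul, norm_inv, Complex.norm_real, Real.norm_of_nonneg hr0.le, ← hr,
      inv_mul_cancel₀ hr0.ne']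
  have hrc : (r : ℂ) ≠ 0 := by exact_mod_cast hr0.ne'
  set D := normMoment ω (2 * a) - normMoment ω (2 * (K * a)) with hD
  have hca := hω.normMoment_pos (2 * a)
  have hDle : normMoment ω (2 * a) ≤ C / (C - 1) * D := by
    rw [div_mul_eq_mul_div, le_div_iff₀ (by linarith), hD]
    have := hCK a ha1
    nlinarith
  have hD0 : 0 < D := by
    have h1 : 0 < C / (C - 1) := div_pos (by linarith) (by linarith)
    exact pos_of_mul_pos_right (hca.trans_le hDle) h1.le
  have hτ : ∀ n : ℕ, ∫ z : ℂ, (‖z‖ ^ 2) ^ n ∂weightedMeasure ω = normMoment ω (2 * n) := by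
    intro n
    simp only [← pow_mul]
    rfl
  have s1 : ∀ w : ℂ, ‖w‖ = 1 → ‖∑ n ∈ Finset.Icc a b,
      (blockCoeff j n * taylorCoeff f n * (normMoment ω (2 * n) : ℂ)) * w ^ n‖
        ≤ normMoment ω (2 * a) * (612 * blochNorm f) := by
    intro w hw
    have h := norm_multiplier_le_of_norm_le_on_circle (ν := weightedMeasure ω)
      (τ := fun z : ℂ => ‖z‖ ^ 2) (a := a) (b := b) (by
        filter_upwards [ae_norm_lt_one] with z hz
        exact ⟨by positivity, pow_le_one₀ (norm_nonneg _) hz.le⟩)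
      (fun n _ => by simpa only [← pow_mul] using hω.integrable_norm_pow (2 * n))
      (fun w hw => hf.norm_block_le j hw) hw
    simpa only [hτ] using h
  have s2 := norm_inv_dilation_le_of_norm_le_on_circle s1 hr0 hz.le hw1
  have hB0 : 0 ≤ 612 * blochNorm f := by
    have := (norm_nonneg _).trans (s1 1 norm_one)
    exact nonneg_of_mul_nonneg_right this hca
  -- With z = rw, the factor z^n / r^(2n) is (w/r)^n.
  have e : blockSymbol ω K f j z = (D : ℂ)⁻¹ * (((r ^ (2 * a) - r ^ (2 * (K * a)) : ℝ) : ℂ) *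
      ∑ n ∈ Finset.Icc a b, (blockCoeff j n * taylorCoeff f n * (normMoment ω (2 * n) : ℂ)) *
        ((r : ℂ)⁻¹ * w) ^ n) := by
    rw [blockSymbol]
    congr 1
    rw [Finset.mul_sum]
    refine Finset.sum_congr rfl fun n _ => ?_
    rw [radialProfile, hw]
    push_cast
    rw [← mul_assoc ((r : ℂ)⁻¹), mul_pow, ← sq, inv_pow, inv_pow, ← pow_mul]
    ring
  have hp0 : 0 ≤ r ^ (2 * a) - r ^ (2 * (K * a)) := by
    have : r ^ (2 * (K * a)) ≤ r ^ (2 * a) :=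
      pow_le_pow_of_le_one hr0.le hz.le (by nlinarith)
    linarith
  have hp := profile_le (K := K) (two_mul_blockHigh_le j) hr0 hz
  rw [e, norm_mul, norm_mul, norm_inv, Complex.norm_real, Complex.norm_real,
    Real.norm_of_nonneg hD0.le, Real.norm_of_nonneg hp0, inv_mul_le_iff₀ hD0]
  have hX : 0 ≤ 4 * K * (a * (1 - √r) * √r ^ a) := (mul_nonneg hp0 (by positivity)).trans hp
  calc (r ^ (2 * a) - r ^ (2 * (K * a))) * ‖∑ n ∈ Finset.Icc a b,
        (blockCoeff j n * taylorCoeff f n * (normMoment ω (2 * n) : ℂ)) * ((r : ℂ)⁻¹ * w) ^ n‖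
      ≤ (r ^ (2 * a) - r ^ (2 * (K * a))) *
          ((r⁻¹) ^ b * (normMoment ω (2 * a) * (612 * blochNorm f))) := by gcongr
    _ = ((r ^ (2 * a) - r ^ (2 * (K * a))) * (r⁻¹) ^ b) *
          (normMoment ω (2 * a) * (612 * blochNorm f)) := by ring
    _ ≤ (4 * K * (a * (1 - √r) * √r ^ a)) * (C / (C - 1) * D * (612 * blochNorm f)) := by
      gcongr
    _ = _ := by ring

lemma sum_norm_blockSymbol_le (hω : IsRadialWeight ω) {C : ℝ} {K : ℕ} (hC : 1 < C) (hK : 1 ≤ K)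
    (hCK : ∀ a : ℕ, 1 ≤ a → C * normMoment ω (2 * (K * a)) ≤ normMoment ω (2 * a))
    {f : ℂ → ℂ} (hf : MemBloch f) {z : ℂ} (hz : ‖z‖ < 1) (J : ℕ) :
    ∑ j ∈ Finset.range J, ‖blockSymbol ω K f j z‖
      ≤ C / (C - 1) * (612 * blochNorm f) * (4 * K) * 10 := by
  have hB : 0 ≤ blochNorm f := by
    have := hf.norm_deriv_le (z := 0) (by simp)
    exact le_trans (by simp) this
  have hC1 : 0 < C - 1 := by linarith
  rcases eq_or_ne z 0 with rfl | hz0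
  · simp only [blockSymbol_zero, norm_zero, Finset.sum_const_zero]
    positivity
  · refine (Finset.sum_le_sum fun j _ => norm_blockSymbol_le hω hC hK hCK hf j hz0 hz).trans ?_
    rw [← Finset.mul_sum]
    refine mul_le_mul_of_nonneg_left (sum_blockLow_mul_pow_le (Real.sqrt_nonneg _) ?_ J)
      (by positivity)
    rw [Real.sqrt_le_one]
    exact hz.le

end Symbol

lemma taylorCoeff_zero (f : ℂ → ℂ) : taylorCoeff f 0 = f 0 := by
  simp [taylorCoeff]

lemma ClassM.bloch_subset_projection (hω : IsRadialWeight ω) (hM : ClassM ω) :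
    ∃ C : ℝ, 0 < C ∧ ∀ f : ℂ → ℂ, MemBloch f → ∃ g : ℂ → ℂ, MemLinfty g ∧
      (∀ z ∈ unitDisc, bergmanProjection ω g z = f z) ∧ linftyNorm g ≤ C * blochNorm f := by
  obtain ⟨C, K, hC, hK, hCK⟩ := hM.exists_nat hω
  have hC1 : 0 < C - 1 := by linarith
  -- The 1 pays for the constant term f(0), which no block contains.
  set E : ℝ := 1 + C / (C - 1) * 612 * (4 * K) * 10 with hE
  have hE0 : 0 < E := by positivity
  refine ⟨E, hE0, fun f hf => ?_⟩
  have hsum := fun {z : ℂ} (hz : ‖z‖ < 1) => sum_norm_blockSymbol_le hω hC hK hCK hf hz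
  have hf0 : ‖f 0‖ ≤ blochNorm f := by
    have h1 : blochDensity f 0 ≤ sSup (blochDensity f '' unitDisc) :=
      le_csSup hf.2 ⟨0, mem_unitDisc.2 (by simp), rfl⟩
    have h2 : 0 ≤ blochDensity f 0 := by simp [blochDensity]
    rw [blochNorm]
    linarith
  have hsm : ∀ {z : ℂ}, ‖z‖ < 1 → Summable fun j => ‖blockSymbol ω K f j z‖ := fun hz =>
    summable_of_sum_range_le (fun _ => norm_nonneg _) (hsum hz)
  set G : ℕ → ℂ → ℂ := fun J z => f 0 + ∑ j ∈ Finset.range J, blockSymbol ω K f j z with hG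
  set g : ℂ → ℂ := fun z => f 0 + ∑' j, blockSymbol ω K f j z with hg
  have hGm : ∀ J, Measurable (G J) := fun J =>
    measurable_const.add (Finset.measurable_fun_sum _ fun j _ => measurable_blockSymbol K f j)
  have hlim : ∀ {z : ℂ}, ‖z‖ < 1 → Tendsto (fun J => G J z) atTop (𝓝 (g z)) := fun hz =>
    (hsm hz).of_norm.hasSum.tendsto_sum_nat.const_add _
  have hGE : ∀ {z : ℂ}, ‖z‖ < 1 → ∀ J, ‖G J z‖ ≤ E * blochNorm f := by
    intro z hz J
    have h1 : ‖∑ j ∈ Finset.range J, blockSymbol ω K f j z‖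
        ≤ C / (C - 1) * (612 * blochNorm f) * (4 * K) * 10 := (norm_sum_le _ _).trans (hsum hz J)
    refine (norm_add_le _ _).trans ((add_le_add hf0 h1).trans (le_of_eq ?_))
    rw [hE]
    ring
  have hgE : ∀ {z : ℂ}, ‖z‖ < 1 → ‖g z‖ ≤ E * blochNorm f := fun hz =>
    le_of_tendsto (hlim hz).norm (Eventually.of_forall (hGE hz))
  have hae : ∀ᵐ z ∂areaMeasure, ‖z‖ < 1 :=
    ae_areaMeasure_mem_unitDisc.mono fun _ h => mem_unitDisc.1 h
  have hgm : AEStronglyMeasurable g areaMeasure :=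
    aestronglyMeasurable_of_tendsto_ae atTop (fun J => (hGm J).aestronglyMeasurable)
      (hae.mono fun z hz => hlim hz)
  have hnorm : eLpNorm g ∞ areaMeasure ≤ ENNReal.ofReal (E * blochNorm f) := by
    rw [eLpNorm_exponent_top]
    exact eLpNormEssSup_le_of_ae_bound (hae.mono fun z hz => hgE hz)
  have hgL : MemLinfty g := ⟨hgm, hnorm.trans_lt ENNReal.ofReal_lt_top⟩
  have hB0 : 0 ≤ blochNorm f := (norm_nonneg _).trans hf0
  have hmom : ∀ m : ℕ, ∫ z, g z * conj z ^ m ∂weightedMeasure ω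
      = taylorCoeff f m * normMoment ω (2 * m) := by
    intro m
    have := hω.isFiniteMeasure
    have hconj : ∀ {z : ℂ}, ‖z‖ < 1 → ‖conj z ^ m‖ ≤ 1 := fun hz => by
      simpa using pow_le_one₀ (norm_nonneg _) hz.le
    have h1 : Tendsto (fun J => ∫ z, G J z * conj z ^ m ∂weightedMeasure ω) atTop
        (𝓝 (∫ z, g z * conj z ^ m ∂weightedMeasure ω)) := by
      refine tendsto_integral_of_dominated_convergence (fun _ => E * blochNorm f)
        (fun J => (hGm J).aestronglyMeasurable.mul (hω.integrable_conj_pow m).aestronglyMeasurable)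
        (integrable_const _) (fun J => ?_) ?_
      · filter_upwards [ae_norm_lt_one] with z hz
        rw [norm_mul]
        exact (mul_le_of_le_one_right (norm_nonneg _) (hconj hz)).trans (hGE hz J)
      · filter_upwards [ae_norm_lt_one] with z hz
        exact (hlim hz).mul_const _
    have hD : ∀ j, normMoment ω (2 * blockLow j) - normMoment ω (2 * (K * blockLow j)) ≠ 0 := by
      intro j
      have h2 := hCK _ (one_le_blockLow j)
      have h3 := hω.normMoment_pos (2 * (K * blockLow j))
      nlinarith
    have hint : ∀ j, Integrable (fun z => blockSymbol ω K f j z * conj z ^ m)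
        (weightedMeasure ω) := by
      intro j
      refine (MemLp.of_bound (p := 1) ((measurable_blockSymbol K f j).aestronglyMeasurable.mul
        (hω.integrable_conj_pow m).aestronglyMeasurable)
        (C / (C - 1) * (612 * blochNorm f) * (4 * K) * 10) ?_).integrable le_rfl
      filter_upwards [ae_norm_lt_one] with z hz
      rw [Pi.mul_apply, norm_mul]
      refine (mul_le_of_le_one_right (norm_nonneg _) (hconj hz)).trans ?_
      refine le_trans ?_ (hsum hz (j + 1))
      exact Finset.single_le_sum (f := fun j => ‖blockSymbol ω K f j z‖)
        (fun _ _ => norm_nonneg _) (Finset.mem_range.2 (Nat.lt_succ_self j))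
    have hval : ∀ J, ∫ z, G J z * conj z ^ m ∂weightedMeasure ω
        = f 0 * (if 0 = m then (normMoment ω (2 * m) : ℂ) else 0)
          + (∑ j ∈ Finset.range J, blockCoeff j m : ℝ) *
            (taylorCoeff f m * normMoment ω (2 * m)) := by
      intro J
      simp only [hG, add_mul, Finset.sum_mul]
      rw [integral_add ((hω.integrable_conj_pow m).const_mul _)
        (integrable_finsetSum _ fun j _ => hint j), integral_const_mul,
        integral_finsetSum _ fun j _ => hint j]
      congr 1
      · have := integral_pow_mul_conj_pow (ω := ω) 0 m
        simp only [pow_zero, one_mul] at this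
        rw [this]
      · push_cast
        rw [Finset.sum_mul]
        refine Finset.sum_congr rfl fun j _ => ?_
        rw [integral_blockSymbol_mul_conj_pow hω hK (hD j)]
        ring
    -- For J ≥ m the block multipliers at frequency m ≥ 1 already sum to 1, so the moments of the
    -- partial sums are eventually constant.
    refine tendsto_nhds_unique h1 (tendsto_const_nhds.congr' ?_)
    filter_upwards [eventually_ge_atTop m] with J hJ
    rw [hval]
    rcases Nat.eq_zero_or_pos m with rfl | hm
    · simp [blockCoeff_zero, taylorCoeff_zero]
    · rw [if_neg (by omega), sum_blockCoeff hm hJ]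
      simp
  refine ⟨g, hgL, fun z hz => ?_, ?_⟩
  · have hz' := mem_unitDisc.1 hz
    refine HasSum.unique (hasSum_bergmanProjection hω (hgL.integrable hω) hz') ?_
    convert hf.1.hasSum_taylorCoeff hz' using 2 with n
    rw [hmom]
    have : (normMoment ω (2 * n) : ℂ) ≠ 0 := by exact_mod_cast (hω.normMoment_pos _).ne'
    field_simp
  · rw [linftyNorm]
    exact ENNReal.toReal_le_of_le_ofReal (mul_nonneg hE0.le hB0) hnorm

end RadialBergman

/-- For a radial weight, the following are equivalent: the continuous embedding of the Bloch space
into `P_ω(L^∞)`; boundedness of the pairing on `A^1_ω × 𝓑`; boundedness of the pairing on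
`𝓑₀ × A^1_ω`; membership in `𝓜`; and the moment inequality for some, or for every, `β > 0`. -/
theorem theorem2 (ω : ℝ → ℝ) (hω : RadialBergman.IsRadialWeight ω) :
    List.TFAE
      [ ∃ C : ℝ, 0 < C ∧ ∀ f : ℂ → ℂ, RadialBergman.MemBloch f →
          ∃ g : ℂ → ℂ, RadialBergman.MemLinfty g ∧
            (∀ z ∈ RadialBergman.unitDisc, RadialBergman.bergmanProjection ω g z = f z) ∧
            RadialBergman.linftyNorm g ≤ C * RadialBergman.blochNorm f,
        ∃ C : ℝ, 0 < C ∧ ∀ f g : ℂ → ℂ,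
          RadialBergman.MemBergman 1 ω f → RadialBergman.MemBloch g →
            ∃ L : ℂ, RadialBergman.HasPairing ω f g L ∧
              ‖L‖ ≤ C * RadialBergman.blochNorm g * RadialBergman.bergmanNorm 1 ω f,
        ∃ C : ℝ, 0 < C ∧ ∀ f g : ℂ → ℂ,
          RadialBergman.MemBergman 1 ω f → RadialBergman.MemLittleBloch g →
            ∃ L : ℂ, RadialBergman.HasPairing ω g f L ∧
              ‖L‖ ≤ C * RadialBergman.blochNorm g * RadialBergman.bergmanNorm 1 ω f,
        RadialBergman.ClassM ω,
        ∃ β : ℝ, 0 < β ∧ ∃ C : ℝ, 0 < C ∧ ∀ x : ℝ, 1 ≤ x →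
          RadialBergman.moment ω x ≤
            C * x ^ β * RadialBergman.moment (RadialBergman.powerWeight ω β) x,
        ∀ β : ℝ, 0 < β → ∃ C : ℝ, 0 < C ∧ ∀ x : ℝ, 1 ≤ x →
          RadialBergman.moment ω x ≤
            C * x ^ β * RadialBergman.moment (RadialBergman.powerWeight ω β) x ] := by
  tfae_have 1 → 2 := by
    rintro ⟨C, hC, h⟩
    exact ⟨C, hC, fun f g hf hg =>
      RadialBergman.pairing_bounded_of_bloch_subset_projection hω h hf hg⟩
  tfae_have 2 → 3 := by
    rintro ⟨C, hC, h⟩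
    exact ⟨C, hC, fun f g hf hg => RadialBergman.littleBloch_pairing_bounded hω h hf hg⟩
  tfae_have 3 → 4 := by
    rintro ⟨C, hC, h⟩
    exact RadialBergman.classM_of_littleBloch_pairing_bounded hω hC h
  tfae_have 4 → 1 := fun hM => hM.bloch_subset_projection hω
  tfae_have 4 → 6 := fun hM β hβ => hM.moment_le_powerWeight hω hβ
  tfae_have 6 → 5 := fun h => ⟨1, one_pos, h 1 one_pos⟩
  tfae_have 5 → 4 := by
    rintro ⟨β, hβ, C, hC, h⟩
    exact RadialBergman.classM_of_moment_le_powerWeight hω hβ hC h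
  tfae_finish
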